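/- Let $P$ be a finite poset with least element $\hat 0$ and greatest element $\hat 1$, and let $\lambda$ be an edge labeling of $P$, that is, a map assigning to each cover relation $x\lessdot y$ a label $\lambda(x,y)$ in a partially ordered set $\Lambda$. The label sequence of a saturated chain $x_0\lessdot x_1\lessdot\dots\lessdot x_k$ is $\lambda(x_0,x_1),\dots,\lambda(x_{k-1},x_k)$; the chain is ascending if this sequence is non-decreasing. $\lambda$ is an EL-labeling if for all $x<y$ the interval $[x,y]$ has a unique ascending maximal chain, and the label sequence of this chain lexicographically precedes those of all other maximal chains of $[x,y]$. An $S_n$ EL-labeling is an EL-labeling with integer labels such that the label sequence of every maximal chain of $P$ is a permutation of $[n]=\{1,\dots,n\}$ in one-line notation. For maximal chains $m,m'$ of $P$ write $m\to m'$ if there are elements $a<b$ in $m\cap m'$ such that $m$ and $m'$ agree below $a$ and above $b$, $m'$ restricted to $[a,b]$ is $a\lessdot z\lessdot b$ with $z\notin m$ and $\lambda(a,z)\not\le\lambda(z,b)$, and $m$ restricted to $[a,b]$ is the (unique) ascending maximal chain of $[a,b]$. The maximal chain descent order induced by $\lambda$ is the reflexive and transitive closure of $\to$ on the set of maximal chains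 of $P$. The weak order on the symmetric group $S_n$ is defined by $u\le w$ if and only if $w=us_{i_1}\cdots s_{i_k}$ for adjacent transpositions $s_{i_j}=(i_j,i_j+1)$ with $\ell(us_{i_1}\cdots s_{i_j})=\ell(u)+j$ for $1\le j\le k$, where $\ell(w)$ is the least number of adjacent transpositions with product $w$. A finite lattice $L$ is supersolvable if it has an M-chain, that is, a maximal chain $\hat 0=c_0\lessdot c_1\lessdot\dots\lessdot c_n=\hat 1$ such that, for every chain $K$ of $L$, the sublattice generated by $K$ and $\{c_0,\dots,c_n\}$ is distributive; $n$ is then the rank of $L$. The induced M-chain EL-labeling is $\lambda(x,y)=\min\{i : x\vee c_i=y\vee c_i\}$ for $x\lessdot y$. **Theorem.** (1) Let $L$ be a finite supersolvable lattice of rank $n$ and let $\lambda$ be the M-chain EL-labeling induced by an M-chain of $L$. Then every interval of the maximal chain descent order induced by $\lambda$ is isomorphic to an interval of the weak order on $S_n$ via the map assigning to each maximal chain its label sequence. More explicitly, for $m\le m'$ the label sequences $u$ of $m$ and $w$ of $m'$ are permutations of $[n]$ with $u\le w$, and taking label sequences is a poset isomorphism from the closed interval $[m,m']$ onto $[u,w]$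 and from the open interval $(m,m')$ onto $(u,w)$. (2) The same conclusion holds for every finite bounded poset $P$ and every $S_n$ EL-labeling $\lambda$ of $P$. -/

import Mathlib

/-! ### Saturated chains, edge labelings, EL-labelings

An edge labeling of `P` with labels in `Λ` is given as a function `P → P → Λ`; only its values on
cover relations are ever used. -/

/-- `l = [x₀, …, x_k]` lists a saturated chain `x = x₀ ⋖ x₁ ⋖ ⋯ ⋖ x_k = y`, that is, a maximal
chain of the closed interval `[x, y]`. -/
def IsSatChain {P : Type*} [PartialOrder P] (x y : P) (l : List P) : Prop :=
  l.IsChain (· ⋖ ·) ∧ l.head? = some x ∧ l.getLast? = some y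

/-- The maximal chains of a bounded poset (of finite length), listed from bottom to top. -/
def MaxChain (P : Type*) [PartialOrder P] [BoundedOrder P] : Type _ :=
  {l : List P // IsSatChain (⊥ : P) ⊤ l}

/-- The label sequence `lam x₀ x₁, lam x₁ x₂, …, lam x_{k-1} x_k` of the chain `[x₀, …, x_k]`. -/
def labelSeq {P Λ : Type*} (lam : P → P → Λ) (l : List P) : List Λ :=
  List.zipWith lam l l.tail

/-- The label sequence of the chain `l` is non-decreasing. -/
def IsAscending {P Λ : Type*} [PartialOrder Λ] (lam : P → P → Λ) (l : List P) : Prop :=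
  (labelSeq lam l).IsChain (· ≤ ·)

/-- `a` lexicographically precedes `b`: at the first index where they disagree, the entry of `a`
is smaller than the entry of `b`. -/
def LexPrecedes {Λ : Type*} [PartialOrder Λ] (a b : List Λ) : Prop :=
  ∃ (p s t : List Λ) (u v : Λ), a = p ++ u :: s ∧ b = p ++ v :: t ∧ u < v

/-- EL-labelings: every closed interval `[x, y]`, `x < y`, has a unique ascending maximal chain,
and this chain lexicographically precedes all other maximal chains of `[x, y]`. -/
def IsELLabeling {P Λ : Type*} [PartialOrder P] [PartialOrder Λ] (lam : P → P → Λ) : Prop :=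
  ∀ x y : P, x < y → ∃ c : List P, IsSatChain x y c ∧ IsAscending lam c ∧
    (∀ d : List P, IsSatChain x y d → IsAscending lam d → d = c) ∧
    (∀ d : List P, IsSatChain x y d → d ≠ c → LexPrecedes (labelSeq lam c) (labelSeq lam d))

/-! ### The maximal chain descent order -/

/-- `m` increases by a polygon move to `m'`: the two chains agree except between two elements
`a < b`, where `m'` is `a ⋖ z ⋖ b` with a descent at `z`, and `m` is an ascending saturated chain
(the unique one, when `lam` is an EL-labeling) avoiding `z`. -/
def PolygonMove {P Λ : Type*} [PartialOrder P] [BoundedOrder P] [PartialOrder Λ]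
    (lam : P → P → Λ) (m m' : MaxChain P) : Prop :=
  ∃ (p q c : List P) (a z b : P),
    m.1 = p ++ c ++ q ∧ m'.1 = p ++ [a, z, b] ++ q ∧
    IsSatChain a b c ∧ z ∉ c ∧ IsAscending lam c ∧ ¬ lam a z ≤ lam z b

/-- The maximal chains of `P`, ordered by the maximal chain descent order induced by `lam`. -/
def MaxChainDescentOrder {P Λ : Type*} [PartialOrder P] [BoundedOrder P]
    (_lam : P → P → Λ) : Type _ :=
  MaxChain P

/-- The order is the reflexive and transitive closure of the polygon moves. (It is antisymmetric
when `lam` is an EL-labeling.) -/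
instance {P Λ : Type*} [PartialOrder P] [BoundedOrder P] [PartialOrder Λ] (lam : P → P → Λ) :
    Preorder (MaxChainDescentOrder lam) where
  le := Relation.ReflTransGen (PolygonMove lam)
  le_refl _ := Relation.ReflTransGen.refl
  le_trans _ _ _ h h' := Relation.ReflTransGen.trans h h'

/-- The label sequence of a maximal chain. -/
def MaxChainDescentOrder.labels {P Λ : Type*} [PartialOrder P] [BoundedOrder P]
    {lam : P → P → Λ} (m : MaxChainDescentOrder lam) : List Λ :=
  labelSeq lam m.1

/-! ### The weak order on the symmetric group

The set `[n] = {1, …, n}` is modelled by `Fin n`, the element `i : Fin n` standing for `i + 1`. -/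

/-- The adjacent transpositions `s_i = (i, i+1)`. -/
def IsAdjTransposition {n : ℕ} (s : Equiv.Perm (Fin n)) : Prop :=
  ∃ i j : Fin n, (j : ℕ) = (i : ℕ) + 1 ∧ s = Equiv.swap i j

/-- The length of a permutation: the least `k` such that it is a product of `k` adjacent
transpositions. -/
noncomputable def permLength {n : ℕ} (w : Equiv.Perm (Fin n)) : ℕ :=
  sInf {k | ∃ l : List (Equiv.Perm (Fin n)),
    l.length = k ∧ (∀ s ∈ l, IsAdjTransposition s) ∧ l.prod = w}

/-- `S_n`, to be ordered by the weak order. -/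
def WeakOrder (n : ℕ) : Type := Equiv.Perm (Fin n)

/-- `u ≤ w` in the weak order: `w = u s₁ ⋯ s_k` with adjacent transpositions `s_j` such that
`u s₁ ⋯ s_j` has length `ℓ(u) + j` for all `j`. -/
def WeakLE {n : ℕ} (u w : Equiv.Perm (Fin n)) : Prop :=
  ∃ l : List (Equiv.Perm (Fin n)), (∀ s ∈ l, IsAdjTransposition s) ∧ w = u * l.prod ∧
    ∀ j ≤ l.length, permLength (u * (l.take j).prod) = permLength u + j

theorem WeakLE.refl {n : ℕ} (u : Equiv.Perm (Fin n)) : WeakLE u u :=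
  ⟨[], by simp, by simp, by simp⟩

theorem WeakLE.trans {n : ℕ} {u v w : Equiv.Perm (Fin n)} (h : WeakLE u v) (h' : WeakLE v w) :
    WeakLE u w := by
  obtain ⟨l, hl, rfl, hlen⟩ := h
  obtain ⟨l', hl', rfl, hlen'⟩ := h'
  refine ⟨l ++ l', ?_, by simp [mul_assoc], ?_⟩
  · intro s hs
    rcases List.mem_append.1 hs with hs | hs
    · exact hl s hs
    · exact hl' s hs
  · intro j hj
    rw [List.length_append] at hj
    have hfull := hlen l.length le_rfl
    rw [List.take_length] at hfull
    by_cases hjl : j ≤ l.length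
    · rw [List.take_append_of_le_length hjl]
      exact hlen j hjl
    · have h2 := hlen' (j - l.length) (by omega)
      rw [List.take_append, List.take_of_length_le (by omega), List.prod_append, ← mul_assoc, h2,
        hfull]
      omega

theorem WeakLE.antisymm {n : ℕ} {u w : Equiv.Perm (Fin n)} (h : WeakLE u w) (h' : WeakLE w u) :
    u = w := by
  obtain ⟨l, -, hw, hlen⟩ := h
  obtain ⟨l', -, hu, hlen'⟩ := h'
  have h1 := hlen l.length le_rfl
  have h2 := hlen' l'.length le_rfl
  rw [List.take_length, ← hw] at h1
  rw [List.take_length, ← hu] at h2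
  have h0 : l = [] := List.eq_nil_of_length_eq_zero (by omega)
  subst h0
  simpa using hw.symm

instance (n : ℕ) : PartialOrder (WeakOrder n) where
  le u w := WeakLE (n := n) u w
  le_refl u := WeakLE.refl (n := n) u
  le_trans _ _ _ h h' := WeakLE.trans (n := n) h h'
  le_antisymm _ _ h h' := WeakLE.antisymm (n := n) h h'

/-- The one line notation `w(1), w(2), …, w(n)` of a permutation of `[n] = {1, …, n}`. -/
def WeakOrder.oneLine {n : ℕ} (w : WeakOrder n) : List ℕ :=
  List.ofFn fun i : Fin n => ((show Equiv.Perm (Fin n) from w) i : ℕ) + 1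

/-! ### `S_n` EL-labelings and M-chain labelings -/

/-- An `S_n` EL-labeling: an EL-labeling by natural numbers (with their usual order) such that the label sequence of every maximal
chain is a permutation of `[n]`. -/
def IsSnELLabeling {P : Type*} [PartialOrder P] [BoundedOrder P] (n : ℕ) (lam : P → P → ℕ) :
    Prop :=
  IsELLabeling lam ∧ ∀ m : MaxChain P, ∃ w : WeakOrder n, labelSeq lam m.1 = w.oneLine

/-- `⊥ = c₀ ⋖ c₁ ⋖ ⋯ ⋖ c_n = ⊤` is an M-chain of the lattice `L`: a maximal chain which together
with any chain `K` of `L` generates a distributive sublattice. A finite lattice is supersolvable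
when it has an M-chain, and its rank is then the length `n` of this chain. -/
def IsMChain {L : Type*} [Lattice L] [BoundedOrder L] {n : ℕ} (c : Fin (n + 1) → L) : Prop :=
  c 0 = ⊥ ∧ c (Fin.last n) = ⊤ ∧ (∀ i : Fin n, c i.castSucc ⋖ c i.succ) ∧
  ∀ K : Set L, IsChain (· ≤ ·) K →
    ∀ x ∈ latticeClosure (K ∪ Set.range c), ∀ y ∈ latticeClosure (K ∪ Set.range c),
      ∀ z ∈ latticeClosure (K ∪ Set.range c), x ⊓ (y ⊔ z) = (x ⊓ y) ⊔ (x ⊓ z)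

/-- The labeling induced by an M-chain: the cover relation `x ⋖ y` is labeled by the least `i` such
that `x ⊔ c_i = y ⊔ c_i`. -/
noncomputable def mChainLabel {L : Type*} [Lattice L] {n : ℕ} (c : Fin (n + 1) → L) (x y : L) : ℕ :=
  sInf {i : ℕ | ∃ k : Fin (n + 1), (k : ℕ) = i ∧ x ⊔ c k = y ⊔ c k}

/-! ### Isomorphism by taking label sequences -/

/-- Assigning to each maximal chain in `I` its label sequence, read as the one line notation of a
permutation, is an isomorphism of ordered sets from `I` onto `J`. -/
def LabelsGiveIso {P : Type*} [PartialOrder P] [BoundedOrder P] {lam : P → P → ℕ} {n : ℕ}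
    (I : Set (MaxChainDescentOrder lam)) (J : Set (WeakOrder n)) : Prop :=
  ∃ φ : I ≃o J, ∀ c : I, c.1.labels = (φ c).1.oneLine

/-! For an `S_n` EL-labeling any two maximal chains carry the same labels, so a polygon move
replaces an ascending chain by a descent of the same length and swaps two adjacent labels `x < y`.
Taking labels is therefore monotone into the weak order, which is described on words by upward
adjacent swaps (`weakLE_iff`, `SwapLE`) or equivalently by containment of inversions
(`SwapLE.of_pair_sublist`).

Conversely every descent of a chain can be undone by a move, so every permutation below the labels
of `m'` lifts to a chain below `m'` (`IsSnELLabeling.exists_lift`). The crux is that this lift is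
unique (`IsSnELLabeling.eq_of_labels_eq`), by induction on inversions. Two chains from which `m'` is
reached by one move have a common lower bound whose labels stay above a prescribed word
(`IsSnELLabeling.exists_diamond`): undoing two descents of `m'` gives a square or a hexagon, which
closes up because ascending chains in intervals are unique. Surjectivity and injectivity below `m'`
together reflect the order, and this gives the isomorphisms.

For M-chains, distributivity is needed only through two modular laws. Say that `x` collapses step
`j` of the flag when `e (j + 1) ≤ e j ⊔ x`. A cover relation collapses exactly one new step, its
label, so each maximal chain uses each label once. The ascending chain of an interval is built
greedily from the atom with the smallest label. -/

/-! ### Words and adjacent swaps -/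

/-- `l'` is obtained from `l` by swapping an ascending pair of adjacent entries. -/
def SwapUp (l l' : List ℕ) : Prop :=
  ∃ (p : List ℕ) (x y : ℕ) (q : List ℕ), l = p ++ x :: y :: q ∧ l' = p ++ y :: x :: q ∧ x < y

/-- The reflexive and transitive closure of `SwapUp`. -/
abbrev SwapLE : List ℕ → List ℕ → Prop := Relation.ReflTransGen SwapUp

/-- The number of inversions of a word. -/
def invCount : List ℕ → ℕ
  | [] => 0
  | x :: l => l.countP (· < x) + invCount l

theorem SwapUp.perm {l l' : List ℕ} (h : SwapUp l l') : l.Perm l' := by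
  obtain ⟨p, x, y, q, rfl, rfl, -⟩ := h
  exact List.Perm.append_left p (List.Perm.swap _ _ _)

theorem SwapLE.perm {l l' : List ℕ} (h : SwapLE l l') : l.Perm l' := by
  induction h with
  | refl => exact List.Perm.refl _
  | tail _ h ih => exact ih.trans h.perm

theorem SwapUp.cons {l l' : List ℕ} (a : ℕ) (h : SwapUp l l') : SwapUp (a :: l) (a :: l') := by
  obtain ⟨p, x, y, q, rfl, rfl, hxy⟩ := h
  exact ⟨a :: p, x, y, q, rfl, rfl, hxy⟩

theorem SwapLE.cons {l l' : List ℕ} (a : ℕ) (h : SwapLE l l') : SwapLE (a :: l) (a :: l') :=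
  h.lift (a :: ·) fun _ _ => SwapUp.cons a

/-- Only the swapped pair changes its relative order. This makes `invCount` a rank function, used
both for permutation length and for the induction on chains. -/
theorem SwapUp.invCount_eq {l l' : List ℕ} (h : SwapUp l l') : invCount l' = invCount l + 1 := by
  obtain ⟨p, x, y, q, rfl, rfl, hxy⟩ := h
  induction p with
  | nil =>
    simp only [List.nil_append, invCount, List.countP_cons]
    have : ¬ y < x := by omega
    simp [hxy, this]
    omega
  | cons a p ih =>
    have hp : (p ++ y :: x :: q).Perm (p ++ x :: y :: q) :=
      List.Perm.append_left p (List.Perm.swap _ _ _)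
    simp only [List.cons_append, invCount, ih, hp.countP_eq]
    omega

/-! ### Inversions, encoded as two-letter sublists `[b, a]` with `a < b` -/

theorem pair_sublist_cons {b a c : ℕ} {l : List ℕ} :
    [b, a].Sublist (c :: l) ↔ [b, a].Sublist l ∨ (b = c ∧ a ∈ l) := by
  rw [List.sublist_cons_iff]
  constructor
  · rintro (h | ⟨r, hr, h⟩)
    · exact Or.inl h
    · simp only [List.cons.injEq] at hr
      obtain ⟨rfl, rfl⟩ := hr
      exact Or.inr ⟨rfl, by simpa using h⟩
  · rintro (h | ⟨rfl, h⟩)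
    · exact Or.inl h
    · exact Or.inr ⟨[a], rfl, by simpa using h⟩

theorem pair_sublist_swap {p q : List ℕ} {x y a b : ℕ}
    (h : [b, a].Sublist (p ++ x :: y :: q)) :
    [b, a].Sublist (p ++ y :: x :: q) ∨ (b = x ∧ a = y) := by
  induction p with
  | nil =>
    simp only [List.nil_append, pair_sublist_cons, List.mem_cons] at h ⊢
    tauto
  | cons c p ih =>
    simp only [List.cons_append, pair_sublist_cons, List.mem_append, List.mem_cons] at h ⊢
    tauto

theorem SwapUp.pair_sublist {l l' : List ℕ} (h : SwapUp l l') {a b : ℕ} (hab : a < b)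
    (hs : [b, a].Sublist l) : [b, a].Sublist l' := by
  obtain ⟨p, x, y, q, rfl, rfl, hxy⟩ := h
  rcases pair_sublist_swap hs with h | ⟨rfl, rfl⟩
  · exact h
  · omega

theorem SwapLE.pair_sublist {l l' : List ℕ} (h : SwapLE l l') {a b : ℕ} (hab : a < b)
    (hs : [b, a].Sublist l) : [b, a].Sublist l' := by
  induction h with
  | refl => exact hs
  | tail _ h ih => exact h.pair_sublist hab ih

theorem pair_sublist_asymm {l : List ℕ} (hl : l.Nodup) {a b : ℕ} (h : [a, b].Sublist l) :
    ¬ [b, a].Sublist l := by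
  induction l with
  | nil => simp at h
  | cons c l ih =>
    rw [List.nodup_cons] at hl
    rw [pair_sublist_cons] at h ⊢
    have hmem : ∀ {u v}, [u, v].Sublist l → u ∈ l ∧ v ∈ l := fun h =>
      ⟨h.subset (by simp), h.subset (by simp)⟩
    rintro (h' | ⟨rfl, h'⟩)
    · rcases h with h | ⟨rfl, h⟩
      · exact ih hl.2 h h'
      · exact hl.1 (hmem h').2
    · rcases h with h | ⟨rfl, h⟩
      · exact hl.1 (hmem h).2
      · exact hl.1 h

theorem pair_sublist_total {l : List ℕ} {a b : ℕ} (ha : a ∈ l) (hb : b ∈ l) (hab : a ≠ b) :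
    [a, b].Sublist l ∨ [b, a].Sublist l := by
  induction l with
  | nil => simp at ha
  | cons c l ih =>
    simp only [pair_sublist_cons, List.mem_cons] at ha hb ⊢
    by_cases hac : a = c <;> by_cases hbc : b = c <;> simp_all

/-- The positions in a word without repetition are linearly ordered. This supplies the third
non-inversion in the hexagon case of the diamond argument. -/
theorem pair_sublist_trans {l : List ℕ} (hl : l.Nodup) {a b c : ℕ} (h : [a, b].Sublist l)
    (h' : [b, c].Sublist l) : [a, c].Sublist l := by
  induction l with
  | nil => simp at h
  | cons d l ih =>
    rw [List.nodup_cons] at hl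
    have hmem : ∀ {u v}, [u, v].Sublist l → u ∈ l ∧ v ∈ l := fun h =>
      ⟨h.subset (by simp), h.subset (by simp)⟩
    rw [pair_sublist_cons] at h h' ⊢
    rcases h with h | ⟨rfl, h⟩ <;> rcases h' with h' | ⟨rfl, h'⟩
    · exact Or.inl (ih hl.2 h h')
    · exact absurd (hmem h).2 hl.1
    · exact Or.inr ⟨rfl, (hmem h').2⟩
    · exact absurd h hl.1

/-- The letter `h` passes the larger letters of `r` one at a time, each step creating an inversion.
-/
theorem SwapLE.move_left {h : ℕ} (r : List ℕ) (s : List ℕ) (hr : ∀ e ∈ r, h < e) :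
    SwapLE (h :: (r ++ s)) (r ++ h :: s) := by
  induction r with
  | nil => exact Relation.ReflTransGen.refl
  | cons e r ih =>
    refine Relation.ReflTransGen.head ⟨[], h, e, r ++ s, rfl, rfl, hr e (by simp)⟩ ?_
    exact (ih fun e he => hr e (by simp [he])).cons e

/-- Containment of inversions implies comparability. -/
theorem SwapLE.of_pair_sublist {v w : List ℕ} (hw : w.Nodup) (hvw : v.Perm w)
    (h : ∀ a b, a < b → [b, a].Sublist v → [b, a].Sublist w) : SwapLE v w := by
  induction v generalizing w with
  | nil => rw [hvw.nil_eq]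
  | cons e v ih =>
    obtain ⟨r, s, rfl⟩ := List.append_of_mem (hvw.subset List.mem_cons_self)
    have hvrs : v.Perm (r ++ s) := (hvw.trans List.perm_middle).cons_inv
    have hnd : (e :: (r ++ s)).Nodup := List.perm_middle.nodup_iff.1 hw
    -- A smaller `d` preceding `e` in `w` would follow `e` in `v`, so `[e, d]` would be an inversion
    -- of `v` missing from `w`.
    have hr : ∀ d ∈ r, e < d := by
      intro d hd
      by_contra hlt
      have hne : d ≠ e := by
        rintro rfl
        exact (List.nodup_cons.1 hnd).1 (by simp [hd])
      have h1 := h d e (by omega) (pair_sublist_cons.2 (Or.inr ⟨rfl, hvrs.symm.subset (by simp [hd])⟩))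
      refine pair_sublist_asymm hw h1 ?_
      exact (List.singleton_sublist.2 hd).append (List.singleton_sublist.2 List.mem_cons_self)
    refine (SwapLE.cons e (ih (List.nodup_cons.1 hnd).2 hvrs ?_)).trans (SwapLE.move_left r s hr)
    intro a b hab hs
    have hmem : ∀ u ∈ [b, a], u ∈ v := fun u hu => hs.subset hu
    have hev : e ∉ v := (List.nodup_cons.1 (hvw.nodup_iff.2 hw)).1
    -- Deleting `e` from `w` leaves `r ++ s` and keeps the inversion, as neither of its letters is
    -- `e`.
    have h2 := (h a b hab (hs.cons e)).filter (fun u => u ≠ e)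
    have hbe : b ≠ e := fun hb => hev (hb ▸ hmem b (by simp))
    have hae : a ≠ e := fun hb => hev (hb ▸ hmem a (by simp))
    have h3 : (r ++ e :: s).filter (fun u => u ≠ e) = r ++ s := by
      have h4 : ∀ u ∈ r ++ s, u ≠ e := fun u hu he => (List.nodup_cons.1 hnd).1 (he ▸ hu)
      rw [List.filter_append, List.filter_cons_of_neg (by simp), ← List.filter_append]
      exact List.filter_eq_self.2 (by simpa using h4)
    rw [h3] at h2
    simpa [hbe, hae] using h2

/-- A swap that creates no inversion of `v` can be undone while staying above `v`. -/
theorem SwapLE.exchange {v p q : List ℕ} {x y : ℕ} (hw : (p ++ y :: x :: q).Nodup)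
    (h : SwapLE v (p ++ y :: x :: q)) (hxy : ¬ [y, x].Sublist v) :
    SwapLE v (p ++ x :: y :: q) := by
  have hp : (p ++ y :: x :: q).Perm (p ++ x :: y :: q) :=
    List.Perm.append_left p (List.Perm.swap _ _ _)
  refine SwapLE.of_pair_sublist (hp.nodup_iff.1 hw) (h.perm.trans hp) fun a b hab hs => ?_
  rcases pair_sublist_swap (h.pair_sublist hab hs) with h' | ⟨rfl, rfl⟩
  · exact h'
  · exact absurd hs hxy

/-- Inversions persist upwards, so an ascent of the upper word cannot be inverted in `v`. -/
theorem SwapLE.not_pair_sublist {v p q : List ℕ} {x y : ℕ} (hw : (p ++ x :: y :: q).Nodup)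
    (h : SwapLE v (p ++ x :: y :: q)) (hxy : x < y) : ¬ [y, x].Sublist v := fun hs =>
  pair_sublist_asymm hw
    (((List.sublist_append_left [x, y] q).trans (List.sublist_append_right p _)))
    (h.pair_sublist hxy hs)

/-! ### The weak order on one line notations -/

/-- The one line notation of a permutation of `Fin n`, with entries shifted to `1, …, n`. -/
def permWord {n : ℕ} (w : Equiv.Perm (Fin n)) : List ℕ :=
  List.ofFn fun i : Fin n => (w i : ℕ) + 1

theorem permWord_length {n : ℕ} (w : Equiv.Perm (Fin n)) : (permWord w).length = n := by
  simp [permWord]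

theorem permWord_injective {n : ℕ} : Function.Injective (permWord (n := n)) := by
  intro u w h
  have h1 := List.ofFn_injective h
  refine Equiv.ext fun i => Fin.ext ?_
  have := congrFun h1 i
  simpa using this

theorem permWord_nodup {n : ℕ} (w : Equiv.Perm (Fin n)) : (permWord w).Nodup := by
  refine List.nodup_ofFn.2 fun i j h => w.injective (Fin.ext ?_)
  simpa using h

theorem mem_permWord {n : ℕ} (w : Equiv.Perm (Fin n)) (k : ℕ) :
    k ∈ permWord w ↔ 1 ≤ k ∧ k ≤ n := by
  rw [permWord, List.mem_ofFn]
  constructor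
  · rintro ⟨i, rfl⟩
    exact ⟨by omega, by have := (w i).2; omega⟩
  · rintro ⟨h1, h2⟩
    refine ⟨w.symm ⟨k - 1, by omega⟩, ?_⟩
    rw [Equiv.apply_symm_apply]
    simp
    omega

theorem permWord_perm {n : ℕ} (u w : Equiv.Perm (Fin n)) : (permWord u).Perm (permWord w) :=
  (List.perm_ext_iff_of_nodup (permWord_nodup u) (permWord_nodup w)).2 fun k => by
    rw [mem_permWord, mem_permWord]

theorem exists_permWord_eq {n : ℕ} {l : List ℕ} (hl : l.Nodup)
    (hmem : ∀ k, k ∈ l ↔ 1 ≤ k ∧ k ≤ n) : ∃ w : Equiv.Perm (Fin n), l = permWord w := by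
  have hlen : l.length = n := by
    have hp : l.Perm (List.range' 1 n) :=
      (List.perm_ext_iff_of_nodup hl List.nodup_range').2 fun k => by
        rw [hmem, List.mem_range'_1]; omega
    simpa using hp.length_eq
  have hget : ∀ i : Fin n, 1 ≤ l[i.1]'(by omega) ∧ l[i.1]'(by omega) ≤ n := fun i =>
    (hmem _).1 (List.getElem_mem _)
  let f : Fin n → Fin n := fun i => ⟨l[i.1]'(by omega) - 1, by have := hget i; omega⟩
  have hf : Function.Injective f := by
    intro i j hij
    have h1 : l[i.1]'(by omega) - 1 = l[j.1]'(by omega) - 1 := congrArg Fin.val hij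
    have h2 := hget i
    have h3 := hget j
    exact Fin.ext ((hl.getElem_inj_iff (i := i.1) (j := j.1)).1 (by omega))
  refine ⟨Equiv.ofBijective f (Finite.injective_iff_bijective.1 hf), ?_⟩
  refine List.ext_getElem (by rw [permWord_length, hlen]) fun i h1 h2 => ?_
  have := hget ⟨i, by omega⟩
  simp [permWord, f]
  simp at this
  omega

/-- Right multiplication by an adjacent transposition swaps adjacent entries. -/
theorem permWord_mul_swap {n : ℕ} (u : Equiv.Perm (Fin n)) (i j : Fin n)
    (hij : (j : ℕ) = (i : ℕ) + 1) :
    ∃ p q : List ℕ, p.length = i ∧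
      permWord u = p ++ ((u i : ℕ) + 1) :: ((u j : ℕ) + 1) :: q ∧
      permWord (u * Equiv.swap i j) =
        p ++ ((u j : ℕ) + 1) :: ((u i : ℕ) + 1) :: q := by
  have hlen := permWord_length u
  have hlen' := permWord_length (u * Equiv.swap i j)
  have hget : ∀ (w : Equiv.Perm (Fin n)) (k : ℕ) (hk : k < n)
      (hk' : k < (permWord w).length),
      (permWord w)[k] = (w ⟨k, hk⟩ : ℕ) + 1 := by
    intro w k hk hk'
    simp [permWord]
  have hi : (i : ℕ) < n := i.2
  have hj : (i : ℕ) + 1 < n := hij ▸ j.2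
  have hjj : j = ⟨(i : ℕ) + 1, hj⟩ := Fin.ext hij
  have hL : permWord u =
      (permWord u).take i ++
        ((u i : ℕ) + 1) :: ((u j : ℕ) + 1) ::
          (permWord u).drop (i + 2) := by
    conv_lhs => rw [← List.take_append_drop i (permWord u)]
    rw [List.drop_eq_getElem_cons (by omega), List.drop_eq_getElem_cons (by omega),
      hget _ _ hi, hget _ _ hj, hjj]
  refine ⟨_, _, by rw [List.length_take]; omega, hL, ?_⟩
  have hL' : permWord (u * Equiv.swap i j) =
      (permWord (u * Equiv.swap i j)).take i ++
        ((u j : ℕ) + 1) :: ((u i : ℕ) + 1) ::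
          (permWord (u * Equiv.swap i j)).drop (i + 2) := by
    conv_lhs =>
      rw [← List.take_append_drop i (permWord (u * Equiv.swap i j))]
    rw [List.drop_eq_getElem_cons (by omega), List.drop_eq_getElem_cons (by omega),
      hget _ _ hi, hget _ _ hj, ← hjj]
    simp
  have hother : ∀ (k : ℕ) (hk : k < n), k ≠ i → k ≠ i + 1 →
      (u * Equiv.swap i j) ⟨k, hk⟩ = u ⟨k, hk⟩ := by
    intro k hk h1 h2
    rw [Equiv.Perm.mul_apply, Equiv.swap_apply_of_ne_of_ne]
    · intro h; exact h1 (congrArg Fin.val h)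
    · intro h; exact h2 (by rw [← hij]; exact congrArg Fin.val h)
  rw [hL']
  congr 1
  · refine List.ext_getElem (by simp [hlen, hlen']) fun k h1 h2 => ?_
    rw [List.length_take] at h1 h2
    rw [List.getElem_take, List.getElem_take, hget _ _ (by omega), hget _ _ (by omega),
      hother _ _ (by omega) (by omega)]
  · congr 2
    refine List.ext_getElem (by simp [hlen, hlen']) fun k h1 h2 => ?_
    rw [List.length_drop] at h1 h2
    rw [List.getElem_drop, List.getElem_drop, hget _ _ (by omega), hget _ _ (by omega),
      hother _ _ (by omega) (by omega)]

/-- The number of inversions of a permutation. -/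
def permInv {n : ℕ} (w : Equiv.Perm (Fin n)) : ℕ :=
  invCount (permWord w)

theorem IsAdjTransposition.swapUp_or {n : ℕ} {s : Equiv.Perm (Fin n)} (hs : IsAdjTransposition s)
    (u : Equiv.Perm (Fin n)) :
    SwapUp (permWord u)
        (permWord (u * s)) ∨
      SwapUp (permWord (u * s))
        (permWord u) := by
  obtain ⟨i, j, hij, rfl⟩ := hs
  obtain ⟨p, q, -, h1, h2⟩ := permWord_mul_swap u i j hij
  have hne : (u i : ℕ) ≠ u j := by
    intro h
    have := u.injective (Fin.ext h)
    rw [this] at hij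
    omega
  rcases Nat.lt_or_gt_of_ne hne with h | h
  · exact Or.inl ⟨p, _, _, q, h1, h2, by omega⟩
  · exact Or.inr ⟨p, _, _, q, h2, h1, by omega⟩

theorem SwapUp.exists_isAdjTransposition {n : ℕ} {u : Equiv.Perm (Fin n)} {l : List ℕ}
    (h : SwapUp (permWord u) l) :
    ∃ s, IsAdjTransposition s ∧ l = permWord (u * s) := by
  obtain ⟨p, x, y, q, h1, rfl, -⟩ := h
  have hlen := permWord_length u
  rw [h1] at hlen
  simp only [List.length_append, List.length_cons] at hlen
  obtain ⟨p', q', hp, h2, h3⟩ := permWord_mul_swap u ⟨p.length, by omega⟩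
    ⟨p.length + 1, by omega⟩ rfl
  refine ⟨_, ⟨⟨p.length, by omega⟩, ⟨p.length + 1, by omega⟩, rfl, rfl⟩, ?_⟩
  rw [h1] at h2
  obtain ⟨rfl, h4⟩ := List.append_inj h2 hp.symm
  simp only [List.cons.injEq] at h4
  obtain ⟨h5, h6, h7⟩ := h4
  subst h7
  rw [h3, h5, h6]

/-- Each swap is right multiplication by the adjacent transposition at its position. The length
condition is phrased with `permInv`, because its equality with `permLength` is itself deduced from
this lemma. -/
theorem SwapLE.exists_word {n : ℕ} {u : Equiv.Perm (Fin n)} {l : List ℕ}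
    (h : SwapLE (permWord u) l) :
    ∃ t : List (Equiv.Perm (Fin n)), (∀ s ∈ t, IsAdjTransposition s) ∧
      l = permWord (u * t.prod) ∧
      ∀ j ≤ t.length, permInv (u * (t.take j).prod) = permInv u + j := by
  induction h with
  | refl => exact ⟨[], by simp, by simp, by simp⟩
  | tail _ h ih =>
    obtain ⟨t, ht, rfl, hinv⟩ := ih
    have hcount := h.invCount_eq
    obtain ⟨s, hs, rfl⟩ := h.exists_isAdjTransposition
    refine ⟨t ++ [s], ?_, by simp [mul_assoc], ?_⟩
    · intro r hr
      rcases List.mem_append.1 hr with hr | hr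
      · exact ht r hr
      · rw [List.mem_singleton.1 hr]; exact hs
    · intro j hj
      rw [List.length_append, List.length_singleton] at hj
      by_cases hjt : j ≤ t.length
      · rw [List.take_append_of_le_length hjt]
        exact hinv j hjt
      · have hjeq : j = (t ++ [s]).length := by simp; omega
        have h1 := hinv t.length le_rfl
        rw [List.take_length] at h1
        rw [hjeq, List.take_length, List.prod_append, List.prod_singleton, ← mul_assoc]
        change permInv (u * t.prod * s) = permInv (u * t.prod) + 1 at hcount
        rw [hcount, h1]
        simp
        omega

theorem permWord_one_pairwise {n : ℕ} :
    (permWord (1 : Equiv.Perm (Fin n))).Pairwise (· < ·) := by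
  rw [permWord, List.pairwise_ofFn]
  intro i j hij
  exact Nat.succ_lt_succ hij

theorem permWord_one_no_inversion {n a b : ℕ} (hab : a < b) :
    ¬ [b, a].Sublist (permWord (1 : Equiv.Perm (Fin n))) := by
  intro h
  have := permWord_one_pairwise.sublist h
  simp at this
  omega

theorem permInv_one {n : ℕ} : permInv (1 : Equiv.Perm (Fin n)) = 0 := by
  have key : ∀ l : List ℕ, l.Pairwise (· < ·) → invCount l = 0 := by
    intro l hl
    induction l with
    | nil => rfl
    | cons a l ih =>
      rw [List.pairwise_cons] at hl
      rw [invCount, ih hl.2, List.countP_eq_zero.2]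
      intro b hb
      have := hl.1 b hb
      simp
      omega
  exact key _ permWord_one_pairwise

/-- The length of a permutation is its number of inversions. -/
theorem permLength_eq_permInv {n : ℕ} (w : Equiv.Perm (Fin n)) : permLength w = permInv w := by
  have hle : ∀ t : List (Equiv.Perm (Fin n)), (∀ s ∈ t, IsAdjTransposition s) →
      permInv t.prod ≤ t.length := by
    intro t
    induction t using List.reverseRecOn with
    | nil => intro _; simp [permInv_one]
    | append_singleton t s ih =>
      intro ht
      have h1 := ih fun r hr => ht r (by simp [hr])
      have h2 : permInv (t.prod * s) ≤ permInv t.prod + 1 := by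
        rcases (ht s (by simp)).swapUp_or t.prod with h | h
        · exact h.invCount_eq.le
        · have := h.invCount_eq
          unfold permInv
          omega
      rw [List.prod_append, List.prod_singleton, List.length_append, List.length_singleton]
      omega
  have hmem : permInv w ∈ {k | ∃ l : List (Equiv.Perm (Fin n)),
      l.length = k ∧ (∀ s ∈ l, IsAdjTransposition s) ∧ l.prod = w} := by
    -- The identity has no inversions, so it lies below `w`. A path of upward swaps between them
    -- spells `w` with exactly `permInv w` letters.
    have h1 : SwapLE (permWord (1 : Equiv.Perm (Fin n)))
        (permWord w) :=
      SwapLE.of_pair_sublist (permWord_nodup _) (permWord_perm _ _)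
        fun a b hab hs => absurd hs (permWord_one_no_inversion hab)
    obtain ⟨t, ht, hw, hlen⟩ := h1.exists_word
    have h2 := permWord_injective hw
    rw [one_mul] at h2
    refine ⟨t, ?_, ht, h2.symm⟩
    have h3 := hlen t.length le_rfl
    rw [List.take_length, one_mul, permInv_one, zero_add] at h3
    rw [← h3]
    exact congrArg permInv h2.symm
  refine le_antisymm (Nat.sInf_le hmem) (le_csInf ⟨_, hmem⟩ ?_)
  rintro k ⟨t, rfl, ht, rfl⟩
  exact hle t ht

/-- The weak order is generated by swapping ascending pairs in one line notation. -/
theorem weakLE_iff {n : ℕ} (u w : Equiv.Perm (Fin n)) :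
    WeakLE u w ↔ SwapLE (permWord u) (permWord w) := by
  constructor
  · rintro ⟨t, ht, rfl, hlen⟩
    induction t using List.reverseRecOn with
    | nil =>
      rw [List.prod_nil, mul_one]
    | append_singleton t s ih =>
      have h1 := ih (fun r hr => ht r (by simp [hr])) fun j hj => by
        have h2 := hlen j (by simp; omega)
        rwa [List.take_append_of_le_length hj] at h2
      refine h1.tail ?_
      have h3 := hlen (t ++ [s]).length le_rfl
      have h4 := hlen t.length (by simp)
      rw [List.take_length, List.prod_append, List.prod_singleton, ← mul_assoc,
        permLength_eq_permInv, permLength_eq_permInv] at h3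
      rw [List.take_left', permLength_eq_permInv, permLength_eq_permInv] at h4
      · rw [List.prod_append, List.prod_singleton, ← mul_assoc]
        -- The prescribed lengths exclude a downward swap.
        rcases (ht s (by simp)).swapUp_or (u * t.prod) with h | h
        · exact h
        · exfalso
          have h5 := h.invCount_eq
          change permInv (u * t.prod) = permInv (u * t.prod * s) + 1 at h5
          rw [List.length_append, List.length_singleton] at h3
          omega
      · rfl
  · intro h
    obtain ⟨t, ht, hw, hlen⟩ := SwapLE.exists_word h
    refine ⟨t, ht, permWord_injective hw, fun j hj => ?_⟩
    rw [permLength_eq_permInv, permLength_eq_permInv]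
    exact hlen j hj

theorem weakOrder_le_iff {n : ℕ} (u w : WeakOrder n) :
    u ≤ w ↔ SwapLE u.oneLine w.oneLine :=
  weakLE_iff (n := n) u w

/-! ### Saturated chains and their label sequences -/

theorem labelSeq_length {P Λ : Type*} (lam : P → P → Λ) (l : List P) :
    (labelSeq lam l).length = l.length - 1 := by
  simp [labelSeq]

theorem labelSeq_append {P Λ : Type*} (lam : P → P → Λ) (p : List P) (a : P) (r : List P) :
    labelSeq lam (p ++ a :: r) = labelSeq lam (p ++ [a]) ++ labelSeq lam (a :: r) := by
  induction p with
  | nil => simp [labelSeq]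
  | cons b p ih =>
    cases p with
    | nil => simp [labelSeq]
    | cons c p =>
      change lam b c :: labelSeq lam (c :: p ++ a :: r) =
        lam b c :: labelSeq lam (c :: p ++ [a]) ++ labelSeq lam (a :: r)
      rw [ih]
      rfl

theorem labelSeq_take {P Λ : Type*} (lam : P → P → Λ) (l : List P) (t : ℕ) :
    labelSeq lam (l.take (t + 1)) = (labelSeq lam l).take t := by
  induction l generalizing t with
  | nil => simp [labelSeq]
  | cons a l ih =>
    cases l with
    | nil => simp [labelSeq]
    | cons b l =>
      cases t with
      | zero => simp [labelSeq]
      | succ t =>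
        change lam a b :: labelSeq lam ((b :: l).take (t + 1)) =
          lam a b :: (labelSeq lam (b :: l)).take t
        rw [ih]

theorem labelSeq_drop {P Λ : Type*} (lam : P → P → Λ) (l : List P) (t : ℕ) :
    labelSeq lam (l.drop t) = (labelSeq lam l).drop t := by
  simp [labelSeq, List.drop_zipWith, List.drop_tail, List.tail_drop]

/-- A decomposition of the label sequence lifts to a decomposition of the chain. -/
theorem exists_append_of_labelSeq_eq {P Λ : Type*} (lam : P → P → Λ) {l : List P} (hl : l ≠ [])
    {A R : List Λ} (h : labelSeq lam l = A ++ R) :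
    ∃ (p : List P) (a : P) (r : List P), l = p ++ a :: r ∧ p.length = A.length ∧
      labelSeq lam (p ++ [a]) = A ∧ labelSeq lam (a :: r) = R := by
  induction A generalizing l with
  | nil =>
    cases l with
    | nil => exact absurd rfl hl
    | cons a r => exact ⟨[], a, r, rfl, rfl, rfl, h⟩
  | cons e A ih =>
    match l, hl, h with
    | [a], _, h => simp [labelSeq] at h
    | a :: b :: l, _, h =>
      change lam a b :: labelSeq lam (b :: l) = e :: (A ++ R) at h
      obtain ⟨h1, h2⟩ := List.cons.inj h
      obtain ⟨p, d, r, h3, h4, h5, h6⟩ := ih (List.cons_ne_nil _ _) h2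
      refine ⟨a :: p, d, r, by rw [h3]; rfl, by simp [h4], ?_, h6⟩
      cases p with
      | nil =>
        obtain ⟨rfl, rfl⟩ := List.cons.inj h3
        simp [labelSeq] at h5 ⊢
        exact ⟨h1, h5⟩
      | cons c p =>
        obtain ⟨rfl, -⟩ := List.cons.inj h3
        change lam a b :: labelSeq lam (b :: p ++ [d]) = _
        rw [h1]
        exact congrArg _ h5

section SatChain

variable {P : Type*} [PartialOrder P]

theorem IsSatChain.ne_nil {x y : P} {l : List P} (h : IsSatChain x y l) : l ≠ [] := by
  rintro rfl
  simpa using h.2.1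

theorem IsSatChain.exists_cons {x y : P} {l : List P} (h : IsSatChain x y l) :
    ∃ r, l = x :: r :=
  List.head?_eq_some_iff.1 h.2.1

theorem IsSatChain.exists_concat {x y : P} {l : List P} (h : IsSatChain x y l) :
    ∃ r, l = r ++ [y] :=
  List.getLast?_eq_some_iff.1 h.2.2

theorem IsSatChain.pairwise {x y : P} {l : List P} (h : IsSatChain x y l) : l.Pairwise (· < ·) :=
  List.isChain_iff_pairwise.1 (h.1.imp fun _ _ h => CovBy.lt h)

theorem IsSatChain.lt {x y : P} {l : List P} (h : IsSatChain x y l) (hl : 1 < l.length) :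
    x < y := by
  obtain ⟨r, rfl⟩ := h.exists_cons
  have hp := (List.pairwise_cons.1 h.pairwise).1
  have hne : r ≠ [] := by rintro rfl; simp at hl
  have h2 := h.2.2
  rw [List.getLast?_cons_of_ne_nil hne] at h2
  exact hp y (List.mem_of_getLast? h2)

theorem IsSatChain.take {x y : P} {l : List P} (h : IsSatChain x y l) {t : ℕ}
    (ht : t < l.length) : IsSatChain x l[t] (l.take (t + 1)) := by
  refine ⟨h.1.take _, ?_, ?_⟩
  · rw [List.head?_take, if_neg (by omega)]
    exact h.2.1
  · rw [List.take_succ_eq_append_getElem ht, List.getLast?_concat]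

theorem IsSatChain.drop {x y : P} {l : List P} (h : IsSatChain x y l) {t : ℕ}
    (ht : t < l.length) : IsSatChain l[t] y (l.drop t) := by
  refine ⟨h.1.drop _, ?_, ?_⟩
  · rw [List.head?_drop, List.getElem?_eq_getElem ht]
  · rw [List.getLast?_drop, if_neg (by omega)]
    exact h.2.2

/-- Replacing a segment of a saturated chain by another one with the same ends. -/
theorem IsSatChain.replace {x y a b : P} {p c d q : List P} (h : IsSatChain x y (p ++ c ++ q))
    (hc : IsSatChain a b c) (hd : IsSatChain a b d) : IsSatChain x y (p ++ d ++ q) := by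
  obtain ⟨h1, h2, h3⟩ := h
  simp only [List.isChain_append, List.head?_append, List.getLast?_append, hc.2.1, hc.2.2] at h1 h2 h3
  refine ⟨?_, ?_, ?_⟩
  · simp only [List.isChain_append, List.getLast?_append, hd.2.1, hd.2.2]
    exact ⟨⟨h1.1.1, hd.1, h1.1.2.2⟩, h1.2.1, h1.2.2⟩
  · simp only [List.head?_append, hd.2.1]
    exact h2
  · simp only [List.getLast?_append, hd.2.2]
    exact h3

/-- The middle part of a saturated chain `p ++ c ++ q` where `c` has length at least one. -/
theorem IsSatChain.middle {x y a b : P} {p c q : List P} (h : IsSatChain x y (p ++ c ++ q))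
    (ha : c.head? = some a) (hb : c.getLast? = some b) : IsSatChain a b c :=
  ⟨((List.isChain_append.1 (List.isChain_append.1 h.1).1).2).1, ha, hb⟩

theorem IsSatChain.labelSeq_eq {Λ : Type*} (lam : P → P → Λ) {a b : P} {c : List P}
    (hc : IsSatChain a b c) (p q : List P) :
    labelSeq lam (p ++ c ++ q) =
      labelSeq lam (p ++ [a]) ++ (labelSeq lam c ++ labelSeq lam (b :: q)) := by
  obtain ⟨r, hr⟩ := hc.exists_cons
  obtain ⟨s, hs⟩ := hc.exists_concat
  have h1 : p ++ c ++ q = p ++ a :: (r ++ q) := by rw [hr]; simp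
  have h2 : a :: (r ++ q) = s ++ b :: q := by
    rw [← List.cons_append, ← hr, hs]; simp
  rw [h1, labelSeq_append, h2, labelSeq_append lam s, ← hs]

/-- Two maximal chains of the same interval which agree except at places where both have an ascent
are equal. -/
theorem IsELLabeling.eq_of_agree {lam : P → P → ℕ} (hEL : IsELLabeling lam) {x y : P}
    {l₁ l₂ : List P} (h₁ : IsSatChain x y l₁) (h₂ : IsSatChain x y l₂)
    (hlen : l₁.length = l₂.length)
    (h : ∀ k, l₁[k + 1]? = l₂[k + 1]? ∨
      ((∀ a b, (labelSeq lam l₁)[k]? = some a → (labelSeq lam l₁)[k + 1]? = some b → a ≤ b) ∧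
        ∀ a b, (labelSeq lam l₂)[k]? = some a → (labelSeq lam l₂)[k + 1]? = some b → a ≤ b)) :
    l₁ = l₂ := by
  induction hN : l₁.length using Nat.strong_induction_on generalizing x l₁ l₂ with
  | _ N ih =>
  subst hN
  have hpos := List.length_pos_of_ne_nil h₁.ne_nil
  by_cases hone : l₁.length = 1
  · obtain ⟨r, rfl⟩ := h₁.exists_cons
    obtain ⟨s, rfl⟩ := h₂.exists_cons
    have hr : r = [] := by simpa using hone
    have hs : s = [] := by rw [hlen] at hone; simpa using hone
    rw [hr, hs]
  -- The common top is one position of agreement. Cutting at the first one above the bottom leaves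
  -- an initial segment with no agreement inside, hence only ascents there.
  have hex : ∃ t, 1 ≤ t ∧ t < l₁.length ∧ l₁[t]? = l₂[t]? := by
    refine ⟨l₁.length - 1, by omega, by omega, ?_⟩
    have e1 := h₁.2.2
    have e2 := h₂.2.2
    rw [List.getLast?_eq_getElem?] at e1 e2
    rw [e1, hlen, e2]
  classical
  obtain ⟨t, ⟨ht1, htl, hteq⟩, hmin⟩ : ∃ t, (1 ≤ t ∧ t < l₁.length ∧ l₁[t]? = l₂[t]?) ∧
      ∀ s < t, ¬ (1 ≤ s ∧ s < l₁.length ∧ l₁[s]? = l₂[s]?) :=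
    ⟨Nat.find hex, Nat.find_spec hex, fun s hs => Nat.find_min hex hs⟩
  have htl2 : t < l₂.length := hlen ▸ htl
  have heq : l₁[t] = l₂[t] := by
    rw [List.getElem?_eq_getElem htl, List.getElem?_eq_getElem htl2] at hteq
    exact Option.some.inj hteq
  -- The labels with indices `k` and `k + 1` meet at the element with index `k + 1`.
  have hasc : ∀ k, k + 1 < t →
      ((∀ a b, (labelSeq lam l₁)[k]? = some a → (labelSeq lam l₁)[k + 1]? = some b → a ≤ b) ∧
        ∀ a b, (labelSeq lam l₂)[k]? = some a → (labelSeq lam l₂)[k + 1]? = some b → a ≤ b) := by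
    intro k hk
    rcases h k with h' | h'
    · exact absurd ⟨by omega, by omega, h'⟩ (hmin (k + 1) hk)
    · exact h'
  have key : ∀ l : List P, (∀ k, k + 1 < t → ∀ a b, (labelSeq lam l)[k]? = some a →
      (labelSeq lam l)[k + 1]? = some b → a ≤ b) → IsAscending lam (l.take (t + 1)) := by
    intro l hl
    rw [IsAscending, labelSeq_take, List.isChain_iff_getElem]
    intro i hi
    rw [List.length_take] at hi
    refine hl i (by omega) _ _ ?_ ?_ <;>
      rw [List.getElem_take, List.getElem?_eq_getElem]
  have hs1 := h₁.take htl
  have hs2 := h₂.take htl2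
  rw [← heq] at hs2
  have hlt : x < l₁[t] := hs1.lt (by rw [List.length_take]; omega)
  obtain ⟨c, -, -, huniq, -⟩ := hEL _ _ hlt
  -- Both initial segments are the unique ascending chain of `[x, l₁[t]]`.
  have htake : l₁.take (t + 1) = l₂.take (t + 1) :=
    (huniq _ hs1 (key l₁ fun k hk => (hasc k hk).1)).trans
      (huniq _ hs2 (key l₂ fun k hk => (hasc k hk).2)).symm
  have hd2 := h₂.drop htl2
  rw [← heq] at hd2
  have hdrop : l₁.drop t = l₂.drop t := by
    refine ih (l₁.drop t).length (by rw [List.length_drop]; omega) (h₁.drop htl) hd2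
      (by simp [hlen]) ?_ rfl
    intro k
    simp only [labelSeq_drop, List.getElem?_drop, ← add_assoc]
    exact h (t + k)
  have htake' : l₁.take t = l₂.take t := by
    have := congrArg (List.take t) htake
    rwa [List.take_take, List.take_take, Nat.min_eq_left (by omega)] at this
  rw [← List.take_append_drop t l₁, htake', hdrop, List.take_append_drop]

end SatChain

/-! ### Polygon moves for `S_n` EL-labelings -/

section PolygonMove

variable {P : Type*} [PartialOrder P] [BoundedOrder P] {lam : P → P → ℕ} {n : ℕ}

theorem IsSnELLabeling.labels_perm (h : IsSnELLabeling n lam) (m m' : MaxChain P) :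
    (labelSeq lam m.1).Perm (labelSeq lam m'.1) := by
  obtain ⟨u, hu⟩ := h.2 m
  obtain ⟨w, hw⟩ := h.2 m'
  rw [hu, hw]
  exact permWord_perm u w

theorem IsSnELLabeling.labels_nodup (h : IsSnELLabeling n lam) (m : MaxChain P) :
    (labelSeq lam m.1).Nodup := by
  obtain ⟨u, hu⟩ := h.2 m
  rw [hu]
  exact permWord_nodup u

theorem IsSnELLabeling.length_eq (h : IsSnELLabeling n lam) (m m' : MaxChain P) :
    m.1.length = m'.1.length := by
  have h1 := (h.labels_perm m m').length_eq
  rw [labelSeq_length, labelSeq_length] at h1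
  have h2 := List.length_pos_of_ne_nil m.2.ne_nil
  have h3 := List.length_pos_of_ne_nil m'.2.ne_nil
  omega

/-- Replacing a descent `a ⋖ z ⋖ b` by an ascending chain swaps the two labels. -/
theorem IsSnELLabeling.replace_labels (h : IsSnELLabeling n lam) {m m' : MaxChain P}
    {p q c : List P} {a z b : P} (hm : m.1 = p ++ c ++ q) (hm' : m'.1 = p ++ [a, z, b] ++ q)
    (hc : IsSatChain a b c) (hasc : IsAscending lam c) (hdesc : ¬ lam a z ≤ lam z b) :
    labelSeq lam m'.1 =
      labelSeq lam (p ++ [a]) ++ lam a z :: lam z b :: labelSeq lam (b :: q) ∧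
    labelSeq lam m.1 =
      labelSeq lam (p ++ [a]) ++ lam z b :: lam a z :: labelSeq lam (b :: q) ∧
    ∃ z', c = [a, z', b] := by
  have hz : IsSatChain a b [a, z, b] := by
    have := m'.2
    rw [hm'] at this
    exact this.middle rfl rfl
  have h1 : labelSeq lam m'.1 =
      labelSeq lam (p ++ [a]) ++ lam a z :: lam z b :: labelSeq lam (b :: q) := by
    rw [hm', hz.labelSeq_eq lam]
    rfl
  have h2 := hc.labelSeq_eq lam p q
  rw [← hm] at h2
  -- The labels outside `[a, b]` are shared and cancel, so `c` carries the same two labels as `a ⋖ z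
  -- ⋖ b`.
  have hp := h.labels_perm m m'
  rw [h1, h2, List.perm_append_left_iff] at hp
  have hp' : (labelSeq lam c).Perm [lam a z, lam z b] :=
    (List.perm_append_right_iff (labelSeq lam (b :: q))).1 hp
  have hlen := hp'.length_eq
  match hl : labelSeq lam c, hlen with
  | [u, v], _ =>
    rw [IsAscending, hl] at hasc
    have huv : u ≤ v := by simpa using hasc
    rw [hl] at hp'
    -- The sum of the labels determines `v` from `u`. Ascent of `c` against descent at `z` then
    -- forces the reversed order.
    have hswap : u = lam z b ∧ v = lam a z := by
      have hu : u ∈ [lam a z, lam z b] := hp'.subset (by simp)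
      have hs : u + v = lam a z + lam z b := by simpa using hp'.sum_eq
      simp only [List.mem_cons, List.not_mem_nil, or_false] at hu
      omega
    refine ⟨h1, ?_, ?_⟩
    · rw [h2, hl, hswap.1, hswap.2]
      rfl
    · have hcl : c.length = 3 := by
        have := labelSeq_length lam c
        rw [hl] at this
        simp at this
        omega
      obtain ⟨r, hr⟩ := hc.exists_cons
      obtain ⟨s, hs⟩ := hc.exists_concat
      match c, hcl with
      | [c1, c2, c3], _ =>
        have e1 : c1 = a := (List.cons.inj hr).1
        have e2 : c3 = b := by
          have := hc.2.2
          simpa using this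
        exact ⟨c2, by rw [e1, e2]⟩

theorem getElem?_append_middle {α : Type*} (p q : List α) (a z z' b : α) {k : ℕ}
    (hk : k ≠ p.length + 1) :
    (p ++ [a, z, b] ++ q)[k]? = (p ++ [a, z', b] ++ q)[k]? := by
  have happ : ∀ w, p ++ [a, w, b] ++ q = p ++ a :: w :: b :: q := fun w => by simp
  rw [happ, happ]
  by_cases h : k < p.length
  · rw [List.getElem?_append_left h, List.getElem?_append_left h]
  · rw [List.getElem?_append_right (by omega), List.getElem?_append_right (by omega)]
    obtain ⟨j, hj⟩ : ∃ j, k - p.length = j := ⟨_, rfl⟩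
    rw [hj]
    match j, hj with
    | 0, _ => rfl
    | 1, hj => omega
    | j + 2, _ => rfl

/-- A polygon move swaps an ascending pair of adjacent labels, and changes the chain in one
place. -/
theorem PolygonMove.exists_swap (h : IsSnELLabeling n lam) {m m' : MaxChain P}
    (hmm : PolygonMove lam m m') :
    ∃ (A : List ℕ) (x y : ℕ) (B : List ℕ), labelSeq lam m.1 = A ++ x :: y :: B ∧
      labelSeq lam m'.1 = A ++ y :: x :: B ∧ x < y ∧
      ∀ k, k ≠ A.length + 1 → m.1[k]? = m'.1[k]? := by
  obtain ⟨p, q, c, a, z, b, hm, hm', hc, -, hasc, hdesc⟩ := hmm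
  obtain ⟨h1, h2, z', rfl⟩ := h.replace_labels hm hm' hc hasc hdesc
  refine ⟨_, _, _, _, h2, h1, by omega, fun k hk => ?_⟩
  rw [hm, hm']
  refine getElem?_append_middle _ _ _ _ _ _ ?_
  simpa [labelSeq_length] using hk

theorem PolygonMove.swapUp (h : IsSnELLabeling n lam) {m m' : MaxChain P}
    (hmm : PolygonMove lam m m') : SwapUp (labelSeq lam m.1) (labelSeq lam m'.1) := by
  obtain ⟨A, x, y, B, h1, h2, hxy, -⟩ := hmm.exists_swap h
  exact ⟨A, x, y, B, h1, h2, hxy⟩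

/-- Every descent of a maximal chain can be removed by a polygon move. -/
theorem IsSnELLabeling.exists_polygonMove (h : IsSnELLabeling n lam) {m' : MaxChain P}
    {A B : List ℕ} {x y : ℕ} (hm' : labelSeq lam m'.1 = A ++ y :: x :: B) (hxy : x < y) :
    ∃ m : MaxChain P, PolygonMove lam m m' ∧ labelSeq lam m.1 = A ++ x :: y :: B ∧
      ∀ k, k ≠ A.length + 1 → m.1[k]? = m'.1[k]? := by
  obtain ⟨p, a, r, h1, h2, h3, h4⟩ := exists_append_of_labelSeq_eq lam m'.2.ne_nil hm'
  match r, h1, h4 with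
  | [], _, h4 => simp [labelSeq] at h4
  | [z], _, h4 => simp [labelSeq] at h4
  | z :: b :: q, h1, h4 =>
    change lam a z :: lam z b :: labelSeq lam (b :: q) = _ at h4
    simp only [List.cons.injEq] at h4
    obtain ⟨h5, h6, h7⟩ := h4
    have h1' : m'.1 = p ++ [a, z, b] ++ q := by rw [h1]; simp
    have hsat := m'.2
    rw [h1'] at hsat
    have hz : IsSatChain a b [a, z, b] := hsat.middle rfl rfl
    have hab : a < b := hz.lt (by simp)
    obtain ⟨c, hc, hasc, -, -⟩ := h.1 a b hab
    have hdesc : ¬ lam a z ≤ lam z b := by omega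
    let m : MaxChain P := ⟨p ++ c ++ q, hsat.replace hz hc⟩
    obtain ⟨h8, h9, z', hz'⟩ := h.replace_labels (m := m) rfl h1' hc hasc hdesc
    have hmove : PolygonMove lam m m' := by
      refine ⟨p, q, c, a, z, b, rfl, h1', hc, ?_, hasc, hdesc⟩
      -- As `c` has one interior element, `z ∈ c` would make that element `z`, turning the descent
      -- into an ascent.
      intro hzc
      rw [hz'] at hzc hasc
      simp only [List.mem_cons, List.not_mem_nil, or_false] at hzc
      have hp := hz.pairwise
      simp only [List.pairwise_cons, List.mem_cons, List.not_mem_nil, or_false] at hp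
      rcases hzc with rfl | rfl | rfl
      · exact lt_irrefl _ (hp.1 z (Or.inl rfl))
      · refine hdesc ?_
        simpa [IsAscending, labelSeq] using hasc
      · exact lt_irrefl _ (hp.2.1 z rfl)
    refine ⟨m, hmove, by rw [h9, h3, h5, h6, h7], fun k hk => ?_⟩
    change (p ++ c ++ q)[k]? = _
    rw [h1', hz']
    exact getElem?_append_middle _ _ _ _ _ _ (by rw [h2]; exact hk)

/-- Maximal chains which agree except at places where both have an ascent are equal. -/
theorem IsSnELLabeling.eq_of_agree (h : IsSnELLabeling n lam) {m₁ m₂ : MaxChain P} {l : List ℕ}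
    (h₁ : labelSeq lam m₁.1 = l) (h₂ : labelSeq lam m₂.1 = l)
    (hag : ∀ k, m₁.1[k + 1]? = m₂.1[k + 1]? ∨
      ∀ a b, l[k]? = some a → l[k + 1]? = some b → a ≤ b) : m₁ = m₂ := by
  refine Subtype.ext (h.1.eq_of_agree m₁.2 m₂.2 (h.length_eq _ _) fun k => ?_)
  rw [h₁, h₂]
  exact (hag k).imp_right fun h => ⟨h, h⟩

end PolygonMove

/-! ### Order ideals of the maximal chain descent order -/

section Descent

variable {P : Type*} [PartialOrder P] [BoundedOrder P] {lam : P → P → ℕ} {n : ℕ}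

theorem IsSnELLabeling.swapLE_of_reflTransGen (h : IsSnELLabeling n lam) {m m' : MaxChain P}
    (hm : Relation.ReflTransGen (PolygonMove lam) m m') :
    SwapLE (labelSeq lam m.1) (labelSeq lam m'.1) := by
  induction hm with
  | refl => exact Relation.ReflTransGen.refl
  | tail _ h' ih => exact ih.tail (h'.swapUp h)

/-- Swaps lift downwards because every descent can be removed. Upward lifting can fail: an ascent
need not be the source of any move. -/
theorem IsSnELLabeling.exists_lift (h : IsSnELLabeling n lam) {m' : MaxChain P} {l : List ℕ}
    (hl : SwapLE l (labelSeq lam m'.1)) :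
    ∃ m, Relation.ReflTransGen (PolygonMove lam) m m' ∧ labelSeq lam m.1 = l := by
  induction hl using Relation.ReflTransGen.head_induction_on with
  | refl => exact ⟨m', Relation.ReflTransGen.refl, rfl⟩
  | head hs _ ih =>
    obtain ⟨m, hm, hlm⟩ := ih
    obtain ⟨A, x, y, B, rfl, h2, hxy⟩ := hs
    obtain ⟨m₁, hm₁, hl₁, -⟩ := h.exists_polygonMove (hlm.trans h2) hxy
    exact ⟨m₁, Relation.ReflTransGen.head hm₁ hm, hl₁⟩

/-- Two elements covered by `m'` have a common lower bound above any given label sequence which is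
below both of theirs. -/
theorem IsSnELLabeling.exists_diamond (h : IsSnELLabeling n lam) {m₁ m₂ m' : MaxChain P}
    {v A₁ B₁ A₂ B₂ : List ℕ} {x₁ y₁ x₂ y₂ : ℕ}
    (hm₁ : labelSeq lam m₁.1 = A₁ ++ x₁ :: y₁ :: B₁)
    (hm₁' : labelSeq lam m'.1 = A₁ ++ y₁ :: x₁ :: B₁) (h₁ : x₁ < y₁)
    (hag₁ : ∀ k, k ≠ A₁.length + 1 → m₁.1[k]? = m'.1[k]?)
    (hm₂ : labelSeq lam m₂.1 = A₂ ++ x₂ :: y₂ :: B₂)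
    (hm₂' : labelSeq lam m'.1 = A₂ ++ y₂ :: x₂ :: B₂) (h₂ : x₂ < y₂)
    (hag₂ : ∀ k, k ≠ A₂.length + 1 → m₂.1[k]? = m'.1[k]?)
    (hle : A₁.length ≤ A₂.length)
    (hv₁ : SwapLE v (labelSeq lam m₁.1)) (hv₂ : SwapLE v (labelSeq lam m₂.1)) :
    ∃ m, Relation.ReflTransGen (PolygonMove lam) m m₁ ∧
      Relation.ReflTransGen (PolygonMove lam) m m₂ ∧ SwapLE v (labelSeq lam m.1) := by
  have hnd₁ := h.labels_nodup m₁
  have hnd₂ := h.labels_nodup m₂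
  rw [hm₁] at hv₁ hnd₁
  rw [hm₂] at hv₂ hnd₂
  have hn₁ : ¬ [y₁, x₁].Sublist v := hv₁.not_pair_sublist hnd₁ h₁
  have hn₂ : ¬ [y₂, x₂].Sublist v := hv₂.not_pair_sublist hnd₂ h₂
  obtain ⟨D, rfl⟩ : A₁ <+: A₂ :=
    List.prefix_of_prefix_length_le (hm₁' ▸ List.prefix_append _ _) (hm₂' ▸ List.prefix_append _ _)
      hle
  have hD := hm₁'.symm.trans hm₂'
  rw [List.append_assoc, List.append_cancel_left_eq] at hD
  match D, hD with
  -- Same descent: the two chains agree off one element, where both ascend.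
  | [], hD =>
    simp only [List.nil_append, List.cons.injEq] at hD
    obtain ⟨rfl, rfl, rfl⟩ := hD
    rw [List.append_nil] at hm₂ hag₂
    have heq : m₁ = m₂ := by
      refine h.eq_of_agree hm₁ hm₂ fun k => ?_
      by_cases hk : k = A₁.length
      · right
        subst hk
        intro a b ha hb
        simp at ha hb
        omega
      · left
        rw [hag₁ _ (by omega), hag₂ _ (by omega)]
    subst heq
    exact ⟨m₁, Relation.ReflTransGen.refl, Relation.ReflTransGen.refl, hm₁ ▸ hv₁⟩
  -- Adjacent descents: `m'` reads `y₁ x₁ x₂`, strictly decreasing. Both sides of the hexagon are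
  -- followed down to `x₂ x₁ y₁`.
  | [d], hD =>
    simp only [List.cons_append, List.nil_append, List.cons.injEq] at hD
    obtain ⟨rfl, rfl, rfl⟩ := hD
    simp only [List.append_assoc, List.cons_append, List.nil_append] at hm₂ hm₂' hv₂ hnd₂
    simp only [List.length_append, List.length_singleton] at hag₂
    obtain ⟨r₁, hr₁, hl₁, hg₁⟩ := h.exists_polygonMove (m' := m₁) (A := A₁ ++ [x₁]) (B := B₂)
      (y := y₁) (x := x₂) (by rw [hm₁]; simp) (by omega)
    obtain ⟨s₁, hs₁, hl₁', hg₁'⟩ := h.exists_polygonMove (m' := r₁) (A := A₁) (B := y₁ :: B₂)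
      (y := x₁) (x := x₂) (by rw [hl₁]; simp) h₂
    obtain ⟨r₂, hr₂, hl₂, hg₂⟩ := h.exists_polygonMove (m' := m₂) (A := A₁) (B := x₁ :: B₂)
      (y := y₁) (x := x₂) (by rw [hm₂]) (by omega)
    obtain ⟨s₂, hs₂, hl₂', hg₂'⟩ := h.exists_polygonMove (m' := r₂) (A := A₁ ++ [x₂]) (B := B₂)
      (y := y₁) (x := x₁) (by rw [hl₂]; simp) h₁
    rw [List.append_assoc] at hl₂'
    simp only [List.length_append, List.length_singleton] at hg₁ hg₂'
    -- Both chains differ from `m'` only at the two interior elements, where the common word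
    -- ascends.
    have heq : s₁ = s₂ := by
      refine h.eq_of_agree hl₁' hl₂' fun k => ?_
      by_cases hk : k = A₁.length
      · right
        subst hk
        intro a b ha hb
        simp at ha hb
        omega
      by_cases hk' : k = A₁.length + 1
      · right
        subst hk'
        intro a b ha hb
        simp [add_assoc] at ha hb
        omega
      · left
        rw [hg₁' _ (by omega), hg₁ _ (by omega), hag₁ _ (by omega), hg₂' _ (by omega),
          hg₂ _ (by omega), hag₂ _ (by omega)]
    subst heq
    refine ⟨s₁, (Relation.ReflTransGen.single hs₁).tail hr₁,
      (Relation.ReflTransGen.single hs₂).tail hr₂, ?_⟩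
    have hvnd : v.Nodup := hv₁.perm.nodup_iff.2 hnd₁
    have hmem : ∀ e ∈ A₁ ++ x₁ :: y₁ :: x₂ :: B₂, e ∈ v := fun e he => hv₁.perm.symm.subset he
    -- In `v` the letter `x₂` precedes `x₁`, which precedes `y₁`.
    have hn₃ : ¬ [y₁, x₂].Sublist v := by
      have t1 := (pair_sublist_total (hmem x₁ (by simp)) (hmem y₁ (by simp)) h₁.ne).resolve_right
        hn₁
      have t2 := (pair_sublist_total (hmem x₂ (by simp)) (hmem x₁ (by simp)) h₂.ne).resolve_right
        hn₂
      exact pair_sublist_asymm hvnd (pair_sublist_trans hvnd t2 t1)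
    have hlr := h.labels_nodup r₁
    rw [hl₁] at hlr
    rw [hl₁']
    have hv₃ : SwapLE v (A₁ ++ [x₁] ++ x₂ :: y₁ :: B₂) :=
      SwapLE.exchange (by simpa using hnd₁) (by simpa using hv₁) hn₃
    exact SwapLE.exchange (by simpa using hlr) (by simpa using hv₃) hn₂
  -- Descents at distance at least two: undoing them commutes, giving a square.
  | d :: e :: R, hD =>
    simp only [List.cons_append, List.cons.injEq] at hD
    obtain ⟨rfl, rfl, rfl⟩ := hD
    simp only [List.length_append, List.length_cons] at hag₂
    obtain ⟨s₁, hs₁, hl₁, hg₁⟩ := h.exists_polygonMove (m' := m₁) (A := A₁ ++ x₁ :: y₁ :: R)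
      (B := B₂) (y := y₂) (x := x₂) (by rw [hm₁]; simp) h₂
    obtain ⟨s₂, hs₂, hl₂, hg₂⟩ := h.exists_polygonMove (m' := m₂) (A := A₁)
      (B := R ++ x₂ :: y₂ :: B₂) (y := y₁) (x := x₁) (by rw [hm₂]; simp) h₁
    have hl₂' : labelSeq lam s₂.1 = A₁ ++ x₁ :: y₁ :: R ++ x₂ :: y₂ :: B₂ := by rw [hl₂]; simp
    simp only [List.length_append, List.length_cons] at hg₁
    have heq : s₁ = s₂ := by
      refine h.eq_of_agree hl₁ hl₂' fun k => ?_
      by_cases hk : k = A₁.length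
      · right
        subst hk
        intro a b ha hb
        simp at ha hb
        omega
      by_cases hk' : k = (A₁ ++ x₁ :: y₁ :: R).length
      · right
        subst hk'
        intro a b ha hb
        rw [List.getElem?_append_right (by omega)] at ha hb
        simp at ha hb
        omega
      · left
        simp only [List.length_append, List.length_cons] at hk'
        rw [hg₁ _ (by omega), hag₁ _ (by omega), hg₂ _ (by omega), hag₂ _ (by omega)]
    subst heq
    refine ⟨s₁, Relation.ReflTransGen.single hs₁, Relation.ReflTransGen.single hs₂, ?_⟩
    rw [hl₁]
    exact SwapLE.exchange (by simpa using hnd₁) (by simpa using hv₁) hn₂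

/-- A maximal chain below `m'` is determined by its label sequence. -/
theorem IsSnELLabeling.eq_of_labels_eq (h : IsSnELLabeling n lam) {m₁ m₂ m' : MaxChain P}
    (h₁ : Relation.ReflTransGen (PolygonMove lam) m₁ m')
    (h₂ : Relation.ReflTransGen (PolygonMove lam) m₂ m')
    (hl : labelSeq lam m₁.1 = labelSeq lam m₂.1) : m₁ = m₂ := by
  have hmono : ∀ {l l' : List ℕ}, SwapLE l l' → invCount l ≤ invCount l' := by
    intro l l' hll
    induction hll with
    | refl => exact le_rfl
    | tail _ h' ih => have := h'.invCount_eq; omega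
  induction hN : invCount (labelSeq lam m'.1) using Nat.strong_induction_on
    generalizing m₁ m₂ m' with
  | _ N ih =>
  subst hN
  -- If one chain is `m'` itself, so is the other, since a move into `m'` would leave strictly fewer
  -- inversions below it.
  rcases Relation.ReflTransGen.cases_tail h₁ with rfl | ⟨r₁, hr₁, hs₁⟩
  · rcases Relation.ReflTransGen.cases_tail h₂ with rfl | ⟨r₂, hr₂, hs₂⟩
    · rfl
    · have e1 := hmono (h.swapLE_of_reflTransGen hr₂)
      have e2 := (hs₂.swapUp h).invCount_eq
      rw [← hl] at e1
      omega
  rcases Relation.ReflTransGen.cases_tail h₂ with rfl | ⟨r₂, hr₂, hs₂⟩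
  · have e1 := hmono (h.swapLE_of_reflTransGen hr₁)
    have e2 := (hs₁.swapUp h).invCount_eq
    rw [hl] at e1
    omega
  have hlt₁ := (hs₁.swapUp h).invCount_eq
  have hlt₂ := (hs₂.swapUp h).invCount_eq
  have hv₁ := h.swapLE_of_reflTransGen hr₁
  have hv₂ := h.swapLE_of_reflTransGen hr₂
  rw [← hl] at hv₂
  obtain ⟨r, hrr₁, hrr₂, hvr⟩ : ∃ r, Relation.ReflTransGen (PolygonMove lam) r r₁ ∧
      Relation.ReflTransGen (PolygonMove lam) r r₂ ∧
        SwapLE (labelSeq lam m₁.1) (labelSeq lam r.1) := by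
    obtain ⟨A₁, x₁, y₁, B₁, a1, a2, a3, a4⟩ := hs₁.exists_swap h
    obtain ⟨A₂, x₂, y₂, B₂, b1, b2, b3, b4⟩ := hs₂.exists_swap h
    rcases le_total A₁.length A₂.length with hle | hle
    · exact h.exists_diamond a1 a2 a3 a4 b1 b2 b3 b4 hle hv₁ hv₂
    · obtain ⟨r, c1, c2, c3⟩ := h.exists_diamond b1 b2 b3 b4 a1 a2 a3 a4 hle hv₂ hv₁
      exact ⟨r, c2, c1, c3⟩
  -- One lift `z` of the common word lies below both `r₁` and `r₂`, so induction identifies it with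
  -- `m₁` and with `m₂`.
  obtain ⟨z, hz, hlz⟩ := h.exists_lift hvr
  have hz₁ : z = m₁ := ih _ (by omega) (hz.trans hrr₁) hr₁ hlz rfl
  have hz₂ : z = m₂ := ih _ (by omega) (hz.trans hrr₂) hr₂ (hlz.trans hl) rfl
  exact hz₁.symm.trans hz₂

theorem IsSnELLabeling.exists_labels_eq (h : IsSnELLabeling n lam) (m : MaxChainDescentOrder lam) :
    ∃ w : WeakOrder n, m.labels = w.oneLine :=
  h.2 m

/-- The permutation whose one line notation is the label sequence of a maximal chain. -/
noncomputable def IsSnELLabeling.labelPerm (h : IsSnELLabeling n lam)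
    (m : MaxChainDescentOrder lam) : WeakOrder n :=
  (h.exists_labels_eq m).choose

theorem IsSnELLabeling.labels_eq (h : IsSnELLabeling n lam) (m : MaxChainDescentOrder lam) :
    m.labels = (h.labelPerm m).oneLine :=
  (h.exists_labels_eq m).choose_spec

theorem IsSnELLabeling.labelPerm_mono (h : IsSnELLabeling n lam)
    {m m' : MaxChainDescentOrder lam} (hm : m ≤ m') : h.labelPerm m ≤ h.labelPerm m' := by
  rw [weakOrder_le_iff, ← h.labels_eq, ← h.labels_eq]
  exact h.swapLE_of_reflTransGen hm

theorem IsSnELLabeling.exists_labelPerm_eq (h : IsSnELLabeling n lam)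
    {m' : MaxChainDescentOrder lam} {v : WeakOrder n} (hv : v ≤ h.labelPerm m') :
    ∃ m ≤ m', h.labelPerm m = v := by
  rw [weakOrder_le_iff, ← h.labels_eq] at hv
  obtain ⟨m, hm, hl⟩ := h.exists_lift hv
  exact ⟨m, hm, permWord_injective ((h.labels_eq m).symm.trans hl)⟩

theorem IsSnELLabeling.labelPerm_inj (h : IsSnELLabeling n lam)
    {m₁ m₂ m' : MaxChainDescentOrder lam} (h₁ : m₁ ≤ m') (h₂ : m₂ ≤ m')
    (he : h.labelPerm m₁ = h.labelPerm m₂) : m₁ = m₂ := by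
  refine h.eq_of_labels_eq h₁ h₂ ?_
  exact (h.labels_eq m₁).trans ((congrArg _ he).trans (h.labels_eq m₂).symm)

/-- To reflect the order, lift the smaller permutation below `m₂`; uniqueness below `m'` identifies
the lift with `m₁`. The common bound matters, since unrelated chains may share a label sequence. -/
theorem IsSnELLabeling.labelPerm_le_iff (h : IsSnELLabeling n lam)
    {m₁ m₂ m' : MaxChainDescentOrder lam} (h₁ : m₁ ≤ m') (h₂ : m₂ ≤ m') :
    h.labelPerm m₁ ≤ h.labelPerm m₂ ↔ m₁ ≤ m₂ := by
  refine ⟨fun hle => ?_, h.labelPerm_mono⟩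
  obtain ⟨m, hm, he⟩ := h.exists_labelPerm_eq hle
  rwa [← h.labelPerm_inj (hm.trans h₂) h₁ he]

/-- Corresponding subsets of the principal ideals generated by `m'` and its label sequence are
isomorphic by taking label sequences. -/
theorem IsSnELLabeling.labelsGiveIso (h : IsSnELLabeling n lam) {m' : MaxChainDescentOrder lam}
    {I : Set (MaxChainDescentOrder lam)} {J : Set (WeakOrder n)} (hI : ∀ c ∈ I, c ≤ m')
    (hJ : ∀ w ∈ J, w ≤ h.labelPerm m') (hIJ : ∀ c ≤ m', c ∈ I ↔ h.labelPerm c ∈ J) :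
    LabelsGiveIso I J := by
  let f : I → J := fun c => ⟨h.labelPerm c.1, (hIJ c.1 (hI c.1 c.2)).1 c.2⟩
  have hf : Function.Bijective f := by
    constructor
    · intro c d hcd
      exact Subtype.ext (h.labelPerm_inj (hI c.1 c.2) (hI d.1 d.2) (congrArg Subtype.val hcd))
    · intro w
      obtain ⟨c, hc, he⟩ := h.exists_labelPerm_eq (hJ w.1 w.2)
      exact ⟨⟨c, (hIJ c hc).2 (he ▸ w.2)⟩, Subtype.ext he⟩
  refine ⟨⟨Equiv.ofBijective f hf, ?_⟩, fun c => h.labels_eq c.1⟩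
  intro c d
  exact h.labelPerm_le_iff (hI c.1 c.2) (hI d.1 d.2)

/-- Intervals of the maximal chain descent order of an `S_n` EL-labeling are isomorphic to
intervals of the weak order. -/
theorem IsSnELLabeling.interval_iso (h : IsSnELLabeling n lam)
    {m m' : MaxChainDescentOrder lam} (hm : m ≤ m') :
    ∃ u w : WeakOrder n, m.labels = u.oneLine ∧ m'.labels = w.oneLine ∧ u ≤ w ∧
      LabelsGiveIso (Set.Icc m m') (Set.Icc u w) ∧
      LabelsGiveIso (Set.Ioo m m') (Set.Ioo u w) := by
  refine ⟨h.labelPerm m, h.labelPerm m', h.labels_eq m, h.labels_eq m', h.labelPerm_mono hm,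
    h.labelsGiveIso (m' := m') (fun c hc => hc.2) (fun w hw => hw.2) fun c hc => ?_,
    h.labelsGiveIso (m' := m') (fun c hc => hc.2.le) (fun w hw => hw.2.le) fun c hc => ?_⟩
  · rw [Set.mem_Icc, Set.mem_Icc, h.labelPerm_le_iff hm hc, h.labelPerm_le_iff hc le_rfl]
  · rw [Set.mem_Ioo, Set.mem_Ioo, lt_iff_le_not_ge, lt_iff_le_not_ge, lt_iff_le_not_ge,
      lt_iff_le_not_ge, h.labelPerm_le_iff hm hc, h.labelPerm_le_iff hc le_rfl,
      h.labelPerm_le_iff hc hm, h.labelPerm_le_iff le_rfl hc]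

end Descent

/-! ### M-chain labelings are `S_n` EL-labelings -/

/-- The modular laws satisfied by an M-chain, indexed by `ℕ` and constant from `n` on. -/
structure IsModularFlag {L : Type*} [Lattice L] [BoundedOrder L] (n : ℕ) (e : ℕ → L) : Prop where
  zero : e 0 = ⊥
  last : e n = ⊤
  covBy : ∀ i < n, e i ⋖ e (i + 1)
  mono : Monotone e
  inf_sup_right : ∀ (x y : L) (i : ℕ), x ≤ y → y ⊓ (x ⊔ e i) = x ⊔ (y ⊓ e i)
  inf_sup_left : ∀ (y : L) (i j : ℕ), i ≤ j → e j ⊓ (e i ⊔ y) = e i ⊔ (e j ⊓ y)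

/-- `lam` labels a pair `x ≤ y` by the least `i` with `y ≤ x ⊔ e i`. -/
def IsFlagLabeling {L : Type*} [Lattice L] (n : ℕ) (e : ℕ → L) (lam : L → L → ℕ) : Prop :=
  ∀ x y : L, x ≤ y → lam x y ≤ n ∧ y ≤ x ⊔ e (lam x y) ∧ ∀ i, y ≤ x ⊔ e i → lam x y ≤ i

/-- If `x` already collapsed this step, `e j` would do in place of `e (j + 1)`, against minimality
of the label. -/
theorem IsFlagLabeling.not_le_of_eq {L : Type*} [Lattice L] {n : ℕ} {e : ℕ → L}
    {lam : L → L → ℕ} (hlam : IsFlagLabeling n e lam) {x y : L} (hxy : x ⋖ y)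
    {j : ℕ} (hj : j + 1 = lam x y) : ¬ e (j + 1) ≤ e j ⊔ x := by
  intro h
  obtain ⟨-, h2, h3⟩ := hlam x y hxy.le
  have h4 : y ≤ x ⊔ e j := by
    rw [← hj] at h2
    exact h2.trans (sup_le le_sup_left (h.trans (sup_comm _ _).le))
  have := h3 j h4
  omega

section Flag

variable {L : Type*} [Lattice L] [BoundedOrder L] {n : ℕ} {e : ℕ → L} {lam : L → L → ℕ}

/-- By modularity `y ⊓ (x ⊔ e i) = x ⊔ (y ⊓ e i)`; this element lies between `x` and `y`, so it is
one of them. -/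
theorem IsModularFlag.le_sup_iff (he : IsModularFlag n e) {x y : L} (hxy : x ⋖ y) (i : ℕ) :
    y ≤ x ⊔ e i ↔ ¬ y ⊓ e i ≤ x := by
  have hmod := he.inf_sup_right x y i hxy.le
  constructor
  · intro h h'
    rw [inf_eq_left.2 h, sup_eq_left.2 h'] at hmod
    exact hxy.lt.ne' hmod
  · intro h
    have hle : x ⊔ (y ⊓ e i) ≤ y := sup_le hxy.le inf_le_left
    rcases hxy.eq_or_eq le_sup_left hle with h1 | h1
    · exact absurd (sup_eq_left.1 h1) h
    · rw [h1] at hmod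
      exact inf_eq_left.1 hmod

theorem IsFlagLabeling.pos (hlam : IsFlagLabeling n e lam) (he : IsModularFlag n e) {x y : L}
    (hxy : x ⋖ y) : 0 < lam x y := by
  rw [Nat.pos_iff_ne_zero]
  intro h
  have h1 := (hlam x y hxy.le).2.1
  rw [h, he.zero, sup_bot_eq] at h1
  exact hxy.lt.not_ge h1

/-- Along a cover relation exactly one step of the flag is collapsed, namely the label. -/
theorem IsFlagLabeling.le_sup_iff_of_covBy (hlam : IsFlagLabeling n e lam)
    (he : IsModularFlag n e) {x y : L} (hxy : x ⋖ y) {j : ℕ} (hj : j < n) :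
    e (j + 1) ≤ e j ⊔ y ↔ e (j + 1) ≤ e j ⊔ x ∨ j + 1 = lam x y := by
  obtain ⟨h1, h2, h3⟩ := hlam x y hxy.le
  have hmod := he.inf_sup_left y j (j + 1) (Nat.le_succ j)
  have hbelow : ∀ k, k < lam x y → y ⊓ e k ≤ x := by
    intro k hk
    by_contra hc
    have := h3 k ((he.le_sup_iff hxy k).2 hc)
    omega
  constructor
  · intro h
    -- Before the label, `y ⊓ e (j + 1) ≤ x`, so `y` collapses nothing new. After it, `y ≤ x ⊔ e j`,
    -- so `x` and `y` have the same join with `e j`.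
    rcases Nat.lt_trichotomy (j + 1) (lam x y) with hlt | heq | hgt
    · left
      rw [inf_eq_left.2 h] at hmod
      rw [hmod]
      exact sup_le_sup_left ((inf_comm _ _).le.trans (hbelow _ hlt)) _
    · exact Or.inr heq
    · left
      refine h.trans (sup_le le_sup_left ?_)
      refine h2.trans (sup_le le_sup_right ?_)
      exact (he.mono (by omega)).trans le_sup_left
  · rintro (h | h)
    · exact h.trans (sup_le_sup_left hxy.le _)
    · have hle : e j ⊔ (e (j + 1) ⊓ y) ≤ e (j + 1) := sup_le (he.mono (Nat.le_succ j)) inf_le_left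
      rcases (he.covBy j hj).eq_or_eq le_sup_left hle with h4 | h4
      · exfalso
        have h5 : e (j + 1) ⊓ y ≤ e j := sup_eq_left.1 h4
        have h6 : y ⊓ e (j + 1) ≤ x :=
          (le_inf inf_le_left ((inf_comm _ _).le.trans h5)).trans (hbelow j (by omega))
        refine (he.le_sup_iff hxy (j + 1)).1 ?_ h6
        rw [h]
        exact h2
      · rw [h4] at hmod
        exact inf_eq_left.1 hmod

/-! ### Saturated chains by their first step, and the labels they carry -/

theorem IsSatChain.cons_cons {P : Type*} [PartialOrder P] {x y z : P} {l : List P}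
    (h : IsSatChain x y (x :: z :: l)) : x ⋖ z ∧ IsSatChain z y (z :: l) := by
  obtain ⟨h1, -, h3⟩ := h
  rw [List.isChain_cons_cons] at h1
  exact ⟨h1.1, h1.2, rfl, by rwa [List.getLast?_cons_cons] at h3⟩

theorem IsSatChain.cons {P : Type*} [PartialOrder P] {x y z : P} {l : List P} (hxz : x ⋖ z)
    (h : IsSatChain z y (z :: l)) : IsSatChain x y (x :: z :: l) :=
  ⟨List.isChain_cons_cons.2 ⟨hxz, h.1⟩, rfl, by rw [List.getLast?_cons_cons]; exact h.2.2⟩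

theorem IsSatChain.le {P : Type*} [PartialOrder P] {x y : P} {l : List P}
    (h : IsSatChain x y l) : x ≤ y := by
  by_cases hl : 1 < l.length
  · exact (h.lt hl).le
  · obtain ⟨r, rfl⟩ := h.exists_cons
    have hr : r = [] := by simpa using hl
    subst hr
    have := h.2.2
    simp only [List.getLast?_singleton, Option.some.injEq] at this
    exact this.le

theorem IsSatChain.eq_cons_cons {P : Type*} [PartialOrder P] {x y : P} {l : List P}
    (h : IsSatChain x y l) (hxy : x < y) : ∃ z r, l = x :: z :: r := by
  obtain ⟨r, rfl⟩ := h.exists_cons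
  cases r with
  | nil =>
    have := h.2.2
    simp only [List.getLast?_singleton, Option.some.injEq] at this
    exact absurd this hxy.ne
  | cons z r => exact ⟨z, r, rfl⟩

/-- The labels of a maximal chain of `[x, y]` are the steps of the flag collapsed by `y` but not
by `x`, each occurring once. -/
theorem IsFlagLabeling.labelSeq_nodup_and_mem (hlam : IsFlagLabeling n e lam)
    (he : IsModularFlag n e) {x y : L} {l : List L} (hl : IsSatChain x y l) :
    (labelSeq lam l).Nodup ∧ ∀ k, k ∈ labelSeq lam l ↔
      ∃ j < n, k = j + 1 ∧ e (j + 1) ≤ e j ⊔ y ∧ ¬ e (j + 1) ≤ e j ⊔ x := by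
  induction l generalizing x with
  | nil => exact absurd rfl hl.ne_nil
  | cons a l ih =>
    obtain ⟨r, hr⟩ := hl.exists_cons
    obtain ⟨rfl, rfl⟩ := List.cons.inj hr
    cases l with
    | nil =>
      have hxy := hl.2.2
      simp only [List.getLast?_singleton, Option.some.injEq] at hxy
      subst hxy
      simp [labelSeq]
    | cons z l =>
      obtain ⟨hcov, hl'⟩ := hl.cons_cons
      obtain ⟨hnd, hmem⟩ := ih hl'
      have hz : ∀ j < n, e (j + 1) ≤ e j ⊔ z ↔ e (j + 1) ≤ e j ⊔ a ∨ j + 1 = lam a z :=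
        fun j hj => hlam.le_sup_iff_of_covBy he hcov hj
      have hzy : ∀ j, e (j + 1) ≤ e j ⊔ z → e (j + 1) ≤ e j ⊔ y := fun j h =>
        h.trans (sup_le_sup_left hl'.le _)
      have hna : ∀ j, j + 1 = lam a z → ¬ e (j + 1) ≤ e j ⊔ a := fun j hj =>
        hlam.not_le_of_eq hcov hj
      change (lam a z :: labelSeq lam (z :: l)).Nodup ∧
        ∀ k, k ∈ lam a z :: labelSeq lam (z :: l) ↔ _
      constructor
      · rw [List.nodup_cons, hmem]
        refine ⟨?_, hnd⟩
        rintro ⟨j, hj, h1, -, h3⟩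
        exact h3 ((hz j hj).2 (Or.inr h1.symm))
      · intro k
        rw [List.mem_cons, hmem]
        constructor
        · rintro (rfl | ⟨j, hj, rfl, h2, h3⟩)
          · have hpos := hlam.pos he hcov
            have hle := (hlam a z hcov.le).1
            have hj : lam a z - 1 + 1 = lam a z := by omega
            exact ⟨lam a z - 1, by omega, hj.symm,
              hzy _ ((hz _ (by omega)).2 (Or.inr hj)), hna _ hj⟩
          · exact ⟨j, hj, rfl, h2, fun h => h3 ((hz j hj).2 (Or.inl h))⟩
        · rintro ⟨j, hj, rfl, h2, h3⟩
          by_cases h : e (j + 1) ≤ e j ⊔ z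
          · exact Or.inl (((hz j hj).1 h).resolve_left h3)
          · exact Or.inr ⟨j, hj, rfl, h2, h⟩

theorem mem_labelSeq {P Λ : Type*} [PartialOrder P] (lam : P → P → Λ) {x y : P} {l : List P}
    (hl : IsSatChain x y l) {k : Λ} (hk : k ∈ labelSeq lam l) :
    ∃ a b, x ≤ a ∧ a ⋖ b ∧ b ≤ y ∧ k = lam a b := by
  induction l generalizing x with
  | nil => simp [labelSeq] at hk
  | cons a l ih =>
    obtain ⟨r, hr⟩ := hl.exists_cons
    obtain ⟨rfl, rfl⟩ := List.cons.inj hr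
    cases l with
    | nil => simp [labelSeq] at hk
    | cons z l =>
      obtain ⟨hcov, hl'⟩ := hl.cons_cons
      change k ∈ lam a z :: labelSeq lam (z :: l) at hk
      rcases List.mem_cons.1 hk with rfl | hk
      · exact ⟨a, z, le_rfl, hcov, hl'.le, rfl⟩
      · obtain ⟨b, d, h1, h2⟩ := ih hl' hk
        exact ⟨b, d, hcov.le.trans h1, h2⟩

/-- The first step of the ascending chain of `[x, y]`. -/
theorem IsFlagLabeling.exists_first_step [Finite L] (hlam : IsFlagLabeling n e lam)
    (he : IsModularFlag n e) {x y : L} (hxy : x < y) :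
    ∃ z, x ⋖ z ∧ z ≤ y ∧ (∀ a b, x ≤ a → a ⋖ b → b ≤ y → lam x z ≤ lam a b) ∧
      ∀ z', x ⋖ z' → z' ≤ y → lam x z' = lam x z → z' = z := by
  classical
  -- The least such index `t` will be the smallest label occurring in `[x, y]`.
  have hex : ∃ i, ¬ y ⊓ e i ≤ x := ⟨n, by rw [he.last, inf_top_eq]; exact hxy.not_ge⟩
  obtain ⟨t, ht, hmin⟩ : ∃ t, ¬ y ⊓ e t ≤ x ∧ ∀ i, ¬ y ⊓ e i ≤ x → t ≤ i :=
    ⟨Nat.find hex, Nat.find_spec hex, fun i hi => Nat.find_min' hex hi⟩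
  have hge : ∀ a b, x ≤ a → a ⋖ b → b ≤ y → t ≤ lam a b := by
    intro a b hxa hab hby
    refine hmin _ fun h => ?_
    refine (he.le_sup_iff hab _).1 (hlam a b hab.le).2.1 ?_
    exact (inf_le_inf_right _ hby).trans (h.trans hxa)
  obtain ⟨z, hz⟩ : ∃ z, z = x ⊔ (y ⊓ e t) := ⟨_, rfl⟩
  have hzmod : y ⊓ (x ⊔ e t) = z := by rw [hz, he.inf_sup_right x y t hxy.le]
  have hzy : z ≤ y := hzmod ▸ inf_le_left
  have hzt : z ≤ x ⊔ e t := hzmod ▸ inf_le_right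
  have hxz : x < z := by
    rw [hz]
    exact lt_of_le_of_ne le_sup_left fun h => ht (sup_eq_left.1 h.symm)
  have heq : ∀ a b, x ≤ a → a ⋖ b → b ≤ z → lam a b = t := by
    intro a b hxa hab hbz
    refine le_antisymm ?_ (hge a b hxa hab (hbz.trans hzy))
    exact (hlam a b hab.le).2.2 t (hbz.trans (hzt.trans (sup_le_sup_right hxa _)))
  obtain ⟨w, hxw, hwz⟩ := exists_covBy_le_of_lt hxz
  -- All labels in `[x, z]` equal `t`, but two successive covers cannot collapse the same step, so
  -- `z` covers `x`.
  have hwz' : w = z := by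
    by_contra hne
    obtain ⟨w', hww', hw'z⟩ := exists_covBy_le_of_lt (lt_of_le_of_ne hwz hne)
    have h1 := heq x w le_rfl hxw hwz
    have h2 := heq w w' hxw.le hww' hw'z
    have hpos := hlam.pos he hxw
    have hle := (hlam x w hxw.le).1
    have hj : t - 1 + 1 = t := by omega
    exact hlam.not_le_of_eq hww' (hj.trans h2.symm)
      ((hlam.le_sup_iff_of_covBy he hxw (by omega)).2 (Or.inr (hj.trans h1.symm)))
  subst hwz'
  have hlab := heq x w le_rfl hxw le_rfl
  refine ⟨w, hxw, hzy, fun a b h1 h2 h3 => hlab ▸ hge a b h1 h2 h3, fun z' h1 h2 h3 => ?_⟩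
  -- Having label `t` places `z'` below `y ⊓ (x ⊔ e t)`, which is `w`.
  have h4 : z' ≤ w := by
    rw [← hzmod]
    refine le_inf h2 ?_
    have := (hlam x z' h1.le).2.1
    rwa [h3, hlab] at this
  rcases hxw.eq_or_eq h1.le h4 with h5 | h5
  · exact absurd h5 h1.lt.ne'
  · exact h5

theorem LexPrecedes.cons {Λ : Type*} [PartialOrder Λ] {a b : List Λ} (k : Λ)
    (h : LexPrecedes a b) : LexPrecedes (k :: a) (k :: b) := by
  obtain ⟨p, s, t, u, v, rfl, rfl, huv⟩ := h
  exact ⟨k :: p, s, t, u, v, rfl, rfl, huv⟩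

/-- The ascending chain starts with the unique atom of smallest label and continues recursively. All
maximal chains of an interval use the same labels, so another ascending chain must also start with
the smallest one, while any other first step is lexicographically larger. -/
theorem IsFlagLabeling.isELLabeling [Finite L] (hlam : IsFlagLabeling n e lam)
    (he : IsModularFlag n e) : IsELLabeling lam := by
  intro x y hxy
  -- The induction runs over `x ≤ y`, so that it also applies when the first step already reaches
  -- `y`.
  have hxy' := hxy.le
  clear hxy
  induction x using WellFoundedGT.induction with
  | _ x ih =>
  rcases hxy'.eq_or_lt with rfl | hxy
  · have hone : ∀ d : List L, IsSatChain x x d → d = [x] := by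
      intro d hd
      obtain ⟨r, rfl⟩ := hd.exists_cons
      cases r with
      | nil => rfl
      | cons z r =>
        obtain ⟨h1, h2⟩ := hd.cons_cons
        exact absurd h2.le h1.lt.not_ge
    exact ⟨[x], ⟨List.isChain_singleton _, rfl, rfl⟩, by simp [IsAscending, labelSeq],
      fun d hd _ => hone d hd, fun d hd hne => absurd (hone d hd) hne⟩
  obtain ⟨z, hxz, hzy, hmin, huniq⟩ := hlam.exists_first_step he hxy
  obtain ⟨c, hc, hasc, hcu, hlex⟩ := ih z hxz.lt hzy
  obtain ⟨r, rfl⟩ := hc.exists_cons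
  have hxc := IsSatChain.cons hxz hc
  refine ⟨x :: z :: r, hxc, ?_, ?_, ?_⟩
  · change (lam x z :: labelSeq lam (z :: r)).IsChain (· ≤ ·)
    rw [IsAscending, List.isChain_iff_pairwise] at hasc
    rw [List.isChain_iff_pairwise, List.pairwise_cons]
    refine ⟨fun k hk => ?_, hasc⟩
    obtain ⟨a, b, h1, h2, h3, rfl⟩ := mem_labelSeq lam hc hk
    exact hmin a b (hxz.le.trans h1) h2 h3
  · intro d hd hda
    obtain ⟨z', s, rfl⟩ := hd.eq_cons_cons hxy
    obtain ⟨hxz', hd'⟩ := hd.cons_cons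
    change (lam x z' :: labelSeq lam (z' :: s)).IsChain (· ≤ ·) at hda
    rw [List.isChain_iff_pairwise, List.pairwise_cons] at hda
    have hmem : lam x z ∈ labelSeq lam (x :: z' :: s) := by
      rw [(hlam.labelSeq_nodup_and_mem he hd).2, ← (hlam.labelSeq_nodup_and_mem he hxc).2]
      exact List.mem_cons_self
    have hle : lam x z' ≤ lam x z := by
      rcases List.mem_cons.1 hmem with h | h
      · exact h.ge
      · exact hda.1 _ h
    have heq := huniq z' hxz' hd'.le (le_antisymm hle (hmin x z' le_rfl hxz' hd'.le))
    subst heq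
    rw [hcu _ hd' (List.isChain_iff_pairwise.2 hda.2)]
  · intro d hd hne
    obtain ⟨z', s, rfl⟩ := hd.eq_cons_cons hxy
    obtain ⟨hxz', hd'⟩ := hd.cons_cons
    by_cases hzz : z' = z
    · subst hzz
      exact (hlex _ hd' fun h => hne (congrArg _ h)).cons (lam x z')
    · refine ⟨[], labelSeq lam (z :: r), labelSeq lam (z' :: s), lam x z, lam x z', rfl, rfl, ?_⟩
      exact lt_of_le_of_ne (hmin x z' le_rfl hxz' hd'.le)
        fun h => hzz (huniq z' hxz' hd'.le h.symm)

/-- The bottom collapses no step of the flag and the top collapses all of them, so the labels are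
exactly `1, …, n`. -/
theorem IsFlagLabeling.isSnELLabeling [Finite L] (hlam : IsFlagLabeling n e lam)
    (he : IsModularFlag n e) : IsSnELLabeling n lam := by
  refine ⟨hlam.isELLabeling he, fun m => ?_⟩
  obtain ⟨hnd, hmem⟩ := hlam.labelSeq_nodup_and_mem he m.2
  refine exists_permWord_eq hnd fun k => ?_
  rw [hmem]
  constructor
  · rintro ⟨j, hj, rfl, -⟩
    omega
  · rintro ⟨h1, h2⟩
    refine ⟨k - 1, by omega, by omega, by simp, ?_⟩
    rw [sup_bot_eq]
    exact (he.covBy (k - 1) (by omega)).lt.not_ge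

end Flag

/-- The labeling induced by an M-chain is an `S_n` EL-labeling. -/
theorem IsMChain.isSnELLabeling {L : Type*} [Lattice L] [BoundedOrder L] [Finite L] {n : ℕ}
    {c : Fin (n + 1) → L} (hc : IsMChain c) : IsSnELLabeling n (mChainLabel c) := by
  obtain ⟨h0, hn, hcov, hdist⟩ := hc
  let e : ℕ → L := fun i => c ⟨min i n, by omega⟩
  have hle : ∀ (i : ℕ) (hi : i ≤ n), e i = c ⟨i, by omega⟩ := fun i hi => by
    simp [e, hi]
  have hcovBy : ∀ i < n, e i ⋖ e (i + 1) := fun i hi => by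
    rw [hle i hi.le, hle (i + 1) hi]
    exact hcov ⟨i, hi⟩
  have hmono : Monotone e := monotone_nat_of_le_succ fun i => by
    by_cases hi : i < n
    · exact (hcovBy i hi).le
    · have : min i n = min (i + 1) n := by omega
      simp [e, this]
  have hmem : ∀ (K : Set L) (i : ℕ), e i ∈ latticeClosure (K ∪ Set.range c) := fun K i =>
    subset_latticeClosure (Or.inr ⟨_, rfl⟩)
  have he : IsModularFlag n e := by
    refine ⟨?_, ?_, hcovBy, hmono, ?_, ?_⟩
    · rw [hle 0 (Nat.zero_le n)]; exact h0
    · rw [hle n le_rfl]; exact hn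
    · intro x y i hxy
      -- The distributive law for the chain `{x, y}` becomes modular because `y ⊓ x = x`; the
      -- singleton `{y}` serves likewise for the other law.
      have hK : IsChain (· ≤ ·) ({x, y} : Set L) := IsChain.pair hxy
      have := hdist {x, y} hK y (subset_latticeClosure (Or.inl (by simp))) x
        (subset_latticeClosure (Or.inl (by simp))) (e i) (hmem _ i)
      rwa [inf_eq_right.2 hxy] at this
    · intro y i j hij
      have := hdist {y} IsChain.singleton (e j) (hmem _ j) (e i) (hmem _ i) y
        (subset_latticeClosure (Or.inl (by simp)))
      rwa [inf_eq_right.2 (hmono hij)] at this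
  refine IsFlagLabeling.isSnELLabeling (e := e) (fun x y hxy => ?_) he
  have hiff : ∀ z : L, y ≤ x ⊔ z ↔ x ⊔ z = y ⊔ z := fun z =>
    ⟨fun h => le_antisymm (sup_le_sup_right hxy _) (sup_le h le_sup_right),
      fun h => h ▸ le_sup_left⟩
  have hne : {i : ℕ | ∃ k : Fin (n + 1), (k : ℕ) = i ∧ x ⊔ c k = y ⊔ c k}.Nonempty :=
    ⟨n, Fin.last n, rfl, by rw [hn]; simp⟩
  obtain ⟨k, hk, hk'⟩ := Nat.sInf_mem hne
  change (k : ℕ) = mChainLabel c x y at hk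
  refine ⟨by omega, ?_, fun i hi => ?_⟩
  · rw [hiff, ← hk, hle k (by omega)]
    exact hk'
  · rw [hiff] at hi
    exact (Nat.sInf_le ⟨_, rfl, hi⟩ : mChainLabel c x y ≤ min i n).trans (Nat.min_le_left i n)

theorem mainTheorem6 :
    (∀ (L : Type*) [Lattice L] [BoundedOrder L] [Finite L] (n : ℕ) (c : Fin (n + 1) → L),
      IsMChain c →
      ∀ m m' : MaxChainDescentOrder (mChainLabel c), m ≤ m' →
        ∃ u w : WeakOrder n, m.labels = u.oneLine ∧ m'.labels = w.oneLine ∧ u ≤ w ∧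
          LabelsGiveIso (Set.Icc m m') (Set.Icc u w) ∧
          LabelsGiveIso (Set.Ioo m m') (Set.Ioo u w)) ∧
    (∀ (P : Type*) [PartialOrder P] [BoundedOrder P] [Finite P] (n : ℕ) (lam : P → P → ℕ),
      IsSnELLabeling n lam →
      ∀ m m' : MaxChainDescentOrder lam, m ≤ m' →
        ∃ u w : WeakOrder n, m.labels = u.oneLine ∧ m'.labels = w.oneLine ∧ u ≤ w ∧
          LabelsGiveIso (Set.Icc m m') (Set.Icc u w) ∧
          LabelsGiveIso (Set.Ioo m m') (Set.Ioo u w)) := by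
  refine ⟨fun L _ _ _ n c hc m m' hm => hc.isSnELLabeling.interval_iso hm,
    fun P _ _ _ n lam h m m' hm => h.interval_iso hm⟩
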